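/- **Setting.** Let $n\in\mathbb N$, let $q_{\min},q_{\max},K\in\mathbb R$ and $0\le Q_{\min}\le Q_{\max}<\infty$. Put $Q^{down}(t_0)=Q^{up}(t_0)=0$, $Q^{down}(t_n)=Q_{\min}$, $Q^{up}(t_n)=Q_{\max}$ and, for $1\le k\le n-1$, $$Q^{down}(t_k)=\max\big(0,\,Q_{\min}-(n-k)q_{\max}\big),\qquad Q^{up}(t_k)=\min\big(k\,q_{\max},\,Q_{\max}\big).$$ Let $\mathcal T_k=[Q^{down}(t_k),Q^{up}(t_k)]$ be the interval of achievable cumulative consumptions at $t_k$, and for $Q\in\mathcal T_k$ let $$\mathcal I_{k+1}(Q)=\big[\max(q_{\min},\,Q^{down}(t_{k+1})-Q),\ \min(q_{\max},\,Q^{up}(t_{k+1})-Q)\big]$$ be the interval of volumes that may be bought at $t_k$. It is assumed that $\mathcal I_{k+1}(Q)\neq\emptyset$ for all $0\le k\le n-1$ and $Q\in\mathcal T_k$ (this holds, for instance, if $q_{\min}=0$ and $Q_{\min}\le n\,q_{\max}$). Let $(X_{t_k})_{0\le k\le n}$ be an $\mathbb R^d$-valued Markov process on a probability space $(\Omega,\mathcal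 F,\mathbb P)$, let $g_k:\mathbb R^d\to\mathbb R$, $0\le k\le n-1$, be measurable functions of at most linear growth, and put $\psi(q,X_{t_k})=q\,(g_k(X_{t_k})-K)$. Let $Adm(t_k,Q)$ be the set of random variables with values in $\mathcal I_{k+1}(Q)$ that are measurable with respect to the completed $\sigma$-algebra generated by $X_{t_0},\dots,X_{t_k}$. The value function is defined backwardly by $$V_{n-1}(x,Q)=\sup_{q\in\mathcal I_{n}(Q)}\psi(q,x),\qquad V_k(x,Q)=\sup_{q\in\mathcal I_{k+1}(Q)}\Big[\psi(q,x)+\mathbb E\big(V_{k+1}(X_{t_{k+1}},Q+q)\,\big|\,X_{t_k}=x\big)\Big],\quad 0\le k\le n-2,$$ where the conditional expectations are taken with respect to a regular conditional distribution of $X_{t_{k+1}}$ given $X_{t_k}$. Let $e_1,e_2,\dots:\mathbb R^d\to\mathbb R$ be measurable functions with $e_i(X_{t_k})\in L^2(\mathbb P)$ for all $i\ge1$ and $0\le k\le n-1$, and put $e^m=(e_1,\dots,e_m)$. The least-squares approximation is defined backwardly by $V^m_{n-1}(X_{t_{n-1}},Q)=\operatorname{ess\,sup}_{q\in Adm(t_{n-1},Q)}\psi(q,X_{t_{n-1}})$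 and, for $0\le k\le n-2$, $$V^m_k(X_{t_k},Q)=\operatorname*{ess\,sup}_{q\in Adm(t_k,Q)}\Big[\psi(q,X_{t_k})+\big\langle\theta_{k+1,m}(Q+q),\,e^m(X_{t_k})\big\rangle\Big],$$ $$\theta_{k+1,m}(Q)=\big(A^k_m\big)^{-1}\,\mathbb E\big(V^m_{k+1}(X_{t_{k+1}},Q)\,e^m(X_{t_k})\big),\qquad \big(A^k_m\big)_{i,j}=\mathbb E\big(e_i(X_{t_k})e_j(X_{t_k})\big),\ 1\le i,j\le m.$$ **Statement.** Assume that for every $0\le k\le n-1$ 1. the sequence $(e_i(X_{t_k}))_{i\ge1}$ is total in $L^2(\sigma(X_{t_k}))$, i.e. its linear span is dense there; 2. for every $m\ge1$ the variables $e_1(X_{t_k}),\dots,e_m(X_{t_k})$ are linearly independent in $L^2(\mathbb P)$, i.e. no non-trivial linear combination of them vanishes almost surely; 3. $X_{t_k}$ has a finite second moment. Then for every $0\le k\le n-1$ $$\lim_{m\to\infty}\ \sup_{Q\in\mathcal T_k}\big\|V^m_k(X_{t_k},Q)-V_k(X_{t_k},Q)\big\|_{L^2(\mathbb P)}=0.$$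 -/

import Mathlib

open MeasureTheory ProbabilityTheory Filter Topology
open scoped ENNReal

noncomputable section

/-- The (firm) volume constraints and the fixed strike of a swing contract with exercise dates
`t_0, …, t_{n-1}` and maturity `t_n`. -/
structure SwingContract where
  /-- number of exercise dates -/
  n : ℕ
  /-- minimal purchase at each date -/
  qmin : ℝ
  /-- maximal purchase at each date -/
  qmax : ℝ
  /-- minimal total purchase -/
  Qmin : ℝ
  /-- maximal total purchase -/
  Qmax : ℝ
  /-- strike price -/
  strike : ℝ

namespace SwingContract

variable (c : SwingContract)

/-- Lower end `Q^down(t_k)` of the achievable cumulative consumption. -/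
def Qdown (k : ℕ) : ℝ :=
  if k = 0 then 0
  else if k < c.n then max 0 (c.Qmin - ((c.n : ℝ) - (k : ℝ)) * c.qmax)
  else c.Qmin

/-- Upper end `Q^up(t_k)` of the achievable cumulative consumption. -/
def Qup (k : ℕ) : ℝ :=
  if k = 0 then 0
  else if k < c.n then min ((k : ℝ) * c.qmax) c.Qmax
  else c.Qmax

/-- The interval `𝒯_k` of achievable cumulative consumptions at `t_k`. -/
def consumption (k : ℕ) : Set ℝ := Set.Icc (c.Qdown k) (c.Qup k)

/-- The interval `ℐ_{k+1}(Q)` of volumes that may be bought at `t_k` when the cumulative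
consumption so far is `Q`. -/
def volumes (k : ℕ) (Q : ℝ) : Set ℝ :=
  Set.Icc (max c.qmin (c.Qdown (k + 1) - Q)) (min c.qmax (c.Qup (k + 1) - Q))

variable {E : Type*}

/-- The profit `ψ(q, x) = q (g_k(x) - K)` at `t_k`. -/
def payoff (g : ℕ → E → ℝ) (k : ℕ) (q : ℝ) (x : E) : ℝ := q * (g k x - c.strike)

variable {Ω : Type*} [MeasurableSpace E]

/-- The natural filtration of `X` at `t_k`. -/
abbrev past (X : ℕ → Ω → E) (k : ℕ) : MeasurableSpace Ω :=
  ⨆ j ≤ k, MeasurableSpace.comap (X j) inferInstance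

/-- `(X_{t_k})_{0 ≤ k ≤ n}` is a Markov process with respect to its natural filtration. -/
def IsMarkov [MeasurableSpace Ω] (μ : Measure Ω) (n : ℕ) (X : ℕ → Ω → E) : Prop :=
  ∀ k < n, ∀ B : Set E, MeasurableSet B →
    μ⟦X (k + 1) ⁻¹' B | past X k⟧
      =ᵐ[μ] μ⟦X (k + 1) ⁻¹' B | MeasurableSpace.comap (X k) inferInstance⟧

/-- The set `Adm(t_k, Q)` of admissible (random) controls at `t_k`: the random variables with
values in `ℐ_{k+1}(Q)` that are measurable with respect to the completed natural filtration at
`t_k`, that is, a.s. equal to a variable measurable with respect to the natural filtration. -/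
def adm [MeasurableSpace Ω] (μ : Measure Ω) (X : ℕ → Ω → E) (k : ℕ) (Q : ℝ) : Set (Ω → ℝ) :=
  {q | AEStronglyMeasurable[past X k] q μ ∧ ∀ ω, q ω ∈ c.volumes k Q}

/-- `Z` is (a version of) the essential supremum of the family `S` of random variables. -/
def IsEssSup [MeasurableSpace Ω] (μ : Measure Ω) (S : Set (Ω → ℝ)) (Z : Ω → ℝ) : Prop :=
  Measurable Z ∧ (∀ Y ∈ S, Y ≤ᵐ[μ] Z) ∧
    ∀ Z' : Ω → ℝ, Measurable Z' → (∀ Y ∈ S, Y ≤ᵐ[μ] Z') → Z ≤ᵐ[μ] Z'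

open Classical in
/-- A version of the essential supremum of a family of random variables (`0` if there is no
real-valued essential supremum). -/
def essSupFamily [MeasurableSpace Ω] (μ : Measure Ω) (S : Set (Ω → ℝ)) : Ω → ℝ :=
  if h : ∃ Z, IsEssSup μ S Z then h.choose else 0

/-- The swing value function `V_k(x, Q)`, given by the backward dynamic programming equation.
The expectation given `X_{t_k} = x` is the integral with respect to the regular conditional
distribution of `X_{t_{k+1}}` given `X_{t_k} = x`. -/
def value [StandardBorelSpace E] [Nonempty E] [MeasurableSpace Ω] (μ : Measure Ω)
    [IsFiniteMeasure μ] (X : ℕ → Ω → E) (g : ℕ → E → ℝ) (k : ℕ) (x : E) (Q : ℝ) : ℝ :=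
  if k + 1 < c.n then
    sSup ((fun q : ℝ => c.payoff g k q x
      + ∫ y, value μ X g (k + 1) y (Q + q) ∂(condDistrib (X (k + 1)) (X k) μ x)) ''
        c.volumes k Q)
  else
    sSup ((fun q : ℝ => c.payoff g k q x) '' c.volumes k Q)
termination_by c.n - k

/-- The Gram matrix `A_m^k` with entries `𝔼(e_i(X_{t_k}) e_j(X_{t_k}))`. -/
def gram [MeasurableSpace Ω] (μ : Measure Ω) (X : ℕ → Ω → E) (e : ℕ → E → ℝ) (m k : ℕ) :
    Matrix (Fin m) (Fin m) ℝ :=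
  Matrix.of fun i j => ∫ ω, e i (X k ω) * e j (X k ω) ∂μ

/-- The coefficients `(A_m^k)⁻¹ 𝔼(Y e^m(X_{t_k}))` of the least-squares regression of `Y` on
`e^m(X_{t_k})`, where `e^m` consists of the first `m` regression functions. -/
def lsCoeff [MeasurableSpace Ω] (μ : Measure Ω) (X : ℕ → Ω → E) (e : ℕ → E → ℝ) (m k : ℕ)
    (Y : Ω → ℝ) : Fin m → ℝ :=
  Matrix.mulVec (gram μ X e m k)⁻¹ fun i => ∫ ω, Y ω * e i (X k ω) ∂μ

/-- The least-squares approximation `V^m_k(X_{t_k}, Q)` of the swing value function, a random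
variable that is defined backwardly: the continuation value at `Q` is replaced by
`Φ_m(X_{t_k}; θ_{k+1,m}(Q)) = ⟨θ_{k+1,m}(Q), e^m(X_{t_k})⟩`, where `θ_{k+1,m}(Q)` is the vector of
regression coefficients of `V^m_{k+1}(X_{t_{k+1}}, Q)` on `e^m(X_{t_k})`. -/
def lsValue [MeasurableSpace Ω] (μ : Measure Ω) (X : ℕ → Ω → E) (g : ℕ → E → ℝ)
    (e : ℕ → E → ℝ) (m : ℕ) (k : ℕ) (Q : ℝ) : Ω → ℝ :=
  if k + 1 < c.n then
    essSupFamily μ ((fun (q : Ω → ℝ) (ω : Ω) => c.payoff g k (q ω) (X k ω)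
      + ∑ i : Fin m, lsCoeff μ X e m k (lsValue μ X g e m (k + 1) (Q + q ω)) i * e i (X k ω)) ''
        c.adm μ X k Q)
  else
    essSupFamily μ ((fun (q : Ω → ℝ) (ω : Ω) => c.payoff g k (q ω) (X k ω)) '' c.adm μ X k Q)
termination_by c.n - k

end SwingContract

end

/-!
The difficulty is that the supremum over the purchased volume stands inside the `L²` norm, whereas
the regression is controlled in `L²` only for one cumulative consumption at a time. It is an
orthogonal projection, but it is not monotone, so it neither commutes with suprema nor preserves
concavity of the approximate values in the consumption.

What it does preserve is the regularity `H¹` in the consumption `Q` with values in `L²`, which is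
encoded in `L2Control` by the inequality `𝔼 (Z_t - Z_r)² ≤ (t - r) (v t - v r)` for some monotone
`v`. Three facts carry the proof.

* Maximal inequality (`L2Control.exists_maximal`): for continuous paths the same bound holds for
  `𝔼 sup_{r ≤ s ≤ t} (Z_s - Z_r)²`. Hence, under a bound on the total variation of `v` that is
  uniform in `m`, convergence to zero in `L²` for each `Q` entails convergence to zero of the
  suprema over `Q` (`tendsto_lintegral_iSup_zero`).
* The optimization over the volumes is a maximum over a window whose two ends move monotonically and
  at most as fast as `Q`. Its increments are bounded by the oscillations of the continuation value
  along the two ends, so by the maximal inequality it preserves the control up to a constant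
  (`SwingContract.L2Control_stepValue`).
* The regression does not increase the control (`SwingContract.L2Control_regression`), and it
  converges to the conditional expectation given `X_{t_k}` because the regression functions are
  total (`SwingContract.tendsto_secondMoment_regression_sub_condExp`).

By backward induction the approximations are controlled uniformly in `m`, and the true value is
Lipschitz in `Q` with a square integrable constant. The error at `t_k` is at most the supremum over
the consumption of the error of the continuation values. The latter is the regression of the error
at `t_{k+1}`, small by induction, plus the error of the regression of the true value; so it tends to
zero for each consumption, and by the first fact also in the supremum.

Since the objective is continuous in the volume, the essential supremum over the random controls is
the pointwise supremum over the deterministic volumes (`SwingContract.isEssSup_stepValue`).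
-/

noncomputable section

/-! ### Families of random variables with controlled increments -/

section Increments

variable {Ω : Type*} [MeasurableSpace Ω] {μ : Measure Ω}

/-- The second moment `𝔼 f²`, with value `∞` if it is not finite. -/
def secondMoment (μ : Measure Ω) (f : Ω → ℝ) : ℝ≥0∞ := ∫⁻ ω, ENNReal.ofReal (f ω ^ 2) ∂μ

lemma eLpNorm_two_sq (f : Ω → ℝ) : eLpNorm f 2 μ ^ 2 = secondMoment μ f := by
  have h := eLpNorm_nnreal_pow_eq_lintegral (μ := μ) (f := f) (p := 2) (by norm_num)
  have h2 : ((2 : NNReal) : ℝ) = ((2 : ℕ) : ℝ) := by norm_num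
  rw [h2, ENNReal.rpow_natCast] at h
  refine h.trans (lintegral_congr fun ω => ?_)
  rw [ENNReal.rpow_natCast, ← ofReal_norm, ← ENNReal.ofReal_pow (norm_nonneg _),
    Real.norm_eq_abs, sq_abs]

lemma secondMoment_congr_ae {f g : Ω → ℝ} (h : f =ᵐ[μ] g) :
    secondMoment μ f = secondMoment μ g :=
  lintegral_congr_ae (h.mono fun ω hω => by simp only [hω])

lemma secondMoment_lt_top {f : Ω → ℝ} (hf : MemLp f 2 μ) : secondMoment μ f < ∞ := by
  rw [← eLpNorm_two_sq]
  exact ENNReal.pow_lt_top hf.2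

lemma secondMoment_eq_ofReal {f : Ω → ℝ} (hf : MemLp f 2 μ) :
    secondMoment μ f = ENNReal.ofReal (secondMoment μ f).toReal :=
  (ENNReal.ofReal_toReal (secondMoment_lt_top hf).ne).symm

lemma AEMeasurable.ofReal_sq {f : Ω → ℝ} (hf : AEMeasurable f μ) :
    AEMeasurable (fun ω => ENNReal.ofReal (f ω ^ 2)) μ :=
  (hf.pow_const 2).ennreal_ofReal

lemma ofReal_add_sq_le (a b : ℝ) :
    ENNReal.ofReal ((a + b) ^ 2) ≤ 2 * ENNReal.ofReal (a ^ 2) + 2 * ENNReal.ofReal (b ^ 2) := by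
  have h2 : (2 : ℝ≥0∞) = ENNReal.ofReal 2 := by simp
  rw [h2, ← ENNReal.ofReal_mul zero_le_two, ← ENNReal.ofReal_mul zero_le_two,
    ← ENNReal.ofReal_add (by positivity) (by positivity)]
  exact ENNReal.ofReal_le_ofReal (by nlinarith [sq_nonneg (a - b)])

lemma secondMoment_add_le {f g : Ω → ℝ} (hf : AEMeasurable f μ) :
    secondMoment μ (fun ω => f ω + g ω) ≤ 2 * secondMoment μ f + 2 * secondMoment μ g := by
  unfold secondMoment
  rw [← lintegral_const_mul' _ _ (by simp), ← lintegral_const_mul' _ _ (by simp),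
    ← lintegral_add_left' (hf.ofReal_sq.const_mul _)]
  exact lintegral_mono fun ω => ofReal_add_sq_le _ _

lemma secondMoment_sub_le {f g : Ω → ℝ} (hf : AEMeasurable f μ) :
    secondMoment μ (fun ω => f ω - g ω) ≤ 2 * secondMoment μ f + 2 * secondMoment μ g := by
  have h := secondMoment_add_le (g := fun ω => - g ω) hf
  simpa [secondMoment, sub_eq_add_neg] using h

/-- The increments of the family `Z` over the parameter set `s` are controlled in `L²` by the
monotone function `v`: `𝔼 (Z_t - Z_r)² ≤ (t - r) (v t - v r)`. This says that `Z` belongs to the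
Sobolev space `H¹` with values in `L²`, where `v` stands for the primitive of `𝔼 (∂Z)²`. -/
structure L2Control (μ : Measure Ω) (Z : ℝ → Ω → ℝ) (s : Set ℝ) (v : ℝ → ℝ) : Prop where
  mono : MonotoneOn v s
  incr : ∀ r ∈ s, ∀ t ∈ s, r ≤ t →
    secondMoment μ (fun ω => Z t ω - Z r ω) ≤ ENNReal.ofReal ((t - r) * (v t - v r))

lemma L2Control.subset {Z : ℝ → Ω → ℝ} {s s' : Set ℝ} {v : ℝ → ℝ} (h : L2Control μ Z s v)
    (hs : s' ⊆ s) : L2Control μ Z s' v :=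
  ⟨h.mono.mono hs, fun r hr t ht hrt => h.incr r (hs hr) t (hs ht) hrt⟩

/-- A family with a square integrable Lipschitz constant `ℓ` is controlled by `𝔼 ℓ² · t`. -/
lemma L2Control.of_lipschitz {Z : ℝ → Ω → ℝ} {s : Set ℝ} {ℓ : Ω → ℝ} (hℓ : MemLp ℓ 2 μ)
    (hZ : ∀ r ∈ s, ∀ t ∈ s, ∀ᵐ ω ∂μ, |Z t ω - Z r ω| ≤ ℓ ω * |t - r|) :
    L2Control μ Z s (fun t => (secondMoment μ ℓ).toReal * t) := by
  refine ⟨fun r _ t _ hrt => by gcongr, fun r hr t ht hrt => ?_⟩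
  calc secondMoment μ (fun ω => Z t ω - Z r ω)
      ≤ ∫⁻ ω, ENNReal.ofReal ((t - r) ^ 2) * ENNReal.ofReal (ℓ ω ^ 2) ∂μ := by
        refine lintegral_mono_ae ((hZ r hr t ht).mono fun ω hω => ?_)
        rw [← ENNReal.ofReal_mul (sq_nonneg _)]
        refine ENNReal.ofReal_le_ofReal ?_
        rw [← sq_abs, ← sq_abs (t - r)]
        calc _ ≤ (ℓ ω * |t - r|) ^ 2 := by gcongr
          _ = _ := by ring
    _ = ENNReal.ofReal ((t - r) ^ 2) * secondMoment μ ℓ :=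
        lintegral_const_mul' _ _ ENNReal.ofReal_ne_top
    _ = _ := by
        rw [secondMoment_eq_ofReal hℓ, ← ENNReal.ofReal_mul (sq_nonneg _)]
        simp only [ENNReal.toReal_ofReal ENNReal.toReal_nonneg]
        congr 1; ring

lemma L2Control.sub {Z Y : ℝ → Ω → ℝ} {s : Set ℝ} {v w : ℝ → ℝ} (hZ : L2Control μ Z s v)
    (hY : L2Control μ Y s w) (hm : ∀ t ∈ s, AEMeasurable (Z t) μ) :
    L2Control μ (fun t ω => Z t ω - Y t ω) s (fun t => 2 * v t + 2 * w t) := by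
  refine ⟨fun r hr t ht hrt => by
    have := hZ.mono hr ht hrt
    have := hY.mono hr ht hrt
    linarith, fun r hr t ht hrt => ?_⟩
  have h := secondMoment_sub_le (μ := μ) (f := fun ω => Z t ω - Z r ω)
    (g := fun ω => Y t ω - Y r ω) ((hm t ht).sub (hm r hr))
  have h1 : (fun ω => Z t ω - Y t ω - (Z r ω - Y r ω))
      = fun ω => (Z t ω - Z r ω) - (Y t ω - Y r ω) := by ext; ring
  rw [h1]
  refine h.trans ?_
  have h2 : (2 : ℝ≥0∞) = ENNReal.ofReal 2 := by simp
  have hv := hZ.mono hr ht hrt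
  have hw := hY.mono hr ht hrt
  calc _ ≤ 2 * ENNReal.ofReal ((t - r) * (v t - v r))
        + 2 * ENNReal.ofReal ((t - r) * (w t - w r)) := by
          gcongr
          · exact hZ.incr r hr t ht hrt
          · exact hY.incr r hr t ht hrt
    _ = _ := by
      rw [h2, ← ENNReal.ofReal_mul zero_le_two, ← ENNReal.ofReal_mul zero_le_two,
        ← ENNReal.ofReal_add]
      · congr 1; ring
      · have := mul_nonneg (sub_nonneg.2 hrt) (sub_nonneg.2 hv); linarith
      · have := mul_nonneg (sub_nonneg.2 hrt) (sub_nonneg.2 hw); linarith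

/-- Cauchy-Schwarz for telescoping sums. -/
lemma sq_sub_le_mul_sum_sq (z : ℕ → ℝ) {i N : ℕ} (hi : i ≤ N) :
    (z i - z 0) ^ 2 ≤ N * ∑ j ∈ Finset.range N, (z (j + 1) - z j) ^ 2 := by
  rw [← Finset.sum_range_sub]
  refine (sq_sum_le_card_mul_sum_sq).trans ?_
  rw [Finset.card_range]
  gcongr

/-- Maximal inequality: the bound of a controlled family on the increment over `[a, b]` holds for
the supremum of the increments from `a`. On a grid of `N` steps it is the Cauchy-Schwarz inequality
for the telescoping sum; the paths being continuous, Fatou's lemma gives the limit `N → ∞`. -/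
lemma L2Control.exists_maximal {Z : ℝ → Ω → ℝ} {a b : ℝ} {v : ℝ → ℝ} (hab : a ≤ b)
    (hZ : L2Control μ Z (Set.Icc a b) v) (hm : ∀ t ∈ Set.Icc a b, AEMeasurable (Z t) μ)
    (hc : ∀ ω, ContinuousOn (fun t => Z t ω) (Set.Icc a b)) :
    ∃ S : Ω → ℝ≥0∞, AEMeasurable S μ ∧
      (∀ ω, ∀ t ∈ Set.Icc a b, ENNReal.ofReal ((Z t ω - Z a ω) ^ 2) ≤ S ω) ∧
      ∫⁻ ω, S ω ∂μ ≤ ENNReal.ofReal ((b - a) * (v b - v a)) := by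
  set p : ℕ → ℕ → ℝ := fun N i => a + (b - a) * ((i : ℝ) / N) with hp
  have hpmem : ∀ N i, i ≤ N → p N i ∈ Set.Icc a b := by
    intro N i hi
    have h0 : 0 ≤ (i : ℝ) / N := by positivity
    have h1 : (i : ℝ) / N ≤ 1 := div_le_one_of_le₀ (by exact_mod_cast hi) (by positivity)
    have h2 := sub_nonneg.2 hab
    constructor
    · have := mul_nonneg h2 h0; simp only [hp]; linarith
    · have := mul_le_mul_of_nonneg_left h1 h2; simp only [hp]; linarith
  have hp0 : ∀ N, p N 0 = a := by intro N; simp [hp]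
  have hpN : ∀ N : ℕ, N ≠ 0 → p N N = b := by
    intro N hN
    have : (N : ℝ) ≠ 0 := by exact_mod_cast hN
    simp [hp, this]
  set En : ℕ → Ω → ℝ≥0∞ := fun N ω => (N : ℝ≥0∞) * ∑ j ∈ Finset.range N,
    ENNReal.ofReal ((Z (p N (j + 1)) ω - Z (p N j) ω) ^ 2) with hEn
  have hEm : ∀ N, AEMeasurable (En N) μ := fun N => by
    refine AEMeasurable.const_mul (Finset.aemeasurable_fun_sum _ fun j hj => ?_) _
    have hj := Finset.mem_range.1 hj
    exact ((hm _ (hpmem N (j + 1) hj)).sub (hm _ (hpmem N j hj.le))).ofReal_sq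
  have hEint : ∀ N, N ≠ 0 → ∫⁻ ω, En N ω ∂μ ≤ ENNReal.ofReal ((b - a) * (v b - v a)) := by
    intro N hN
    have hN' : (N : ℝ) ≠ 0 := by exact_mod_cast hN
    rw [lintegral_const_mul' _ _ (by simp), lintegral_finsetSum']
    swap
    · intro j hj
      have hj := Finset.mem_range.1 hj
      exact ((hm _ (hpmem N (j + 1) hj)).sub (hm _ (hpmem N j hj.le))).ofReal_sq
    have hstep : ∀ j ∈ Finset.range N,
        ∫⁻ ω, ENNReal.ofReal ((Z (p N (j + 1)) ω - Z (p N j) ω) ^ 2) ∂μ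
          ≤ ENNReal.ofReal ((b - a) / N * (v (p N (j + 1)) - v (p N j))) := by
      intro j hj
      have hj := Finset.mem_range.1 hj
      have hd : p N (j + 1) - p N j = (b - a) / N := by
        simp only [hp]; push_cast; field_simp; ring
      rw [← hd]
      refine hZ.incr _ (hpmem N j hj.le) _ (hpmem N (j + 1) hj) (sub_nonneg.1 ?_)
      rw [hd]
      exact div_nonneg (sub_nonneg.2 hab) (by positivity)
    calc _ ≤ (N : ℝ≥0∞) * ∑ j ∈ Finset.range N,
          ENNReal.ofReal ((b - a) / N * (v (p N (j + 1)) - v (p N j))) := by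
          gcongr with j hj
          exact hstep j hj
      _ = ENNReal.ofReal N * ENNReal.ofReal (∑ j ∈ Finset.range N,
          ((b - a) / N * (v (p N (j + 1)) - v (p N j)))) := by
          rw [ENNReal.ofReal_natCast, ENNReal.ofReal_sum_of_nonneg]
          intro j hj
          have hj := Finset.mem_range.1 hj
          refine mul_nonneg (div_nonneg (sub_nonneg.2 hab) (by positivity)) (sub_nonneg.2 ?_)
          refine hZ.mono (hpmem N j hj.le) (hpmem N (j + 1) hj) ?_
          have := sub_nonneg.2 hab
          simp only [hp]; push_cast; gcongr; linarith
      _ = _ := by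
          rw [← Finset.mul_sum, Finset.sum_range_sub (fun j => v (p N j)), hp0, hpN N hN,
            ← ENNReal.ofReal_mul (by positivity)]
          congr 1; field_simp
  have hlim : AEMeasurable (fun ω => liminf (fun N => En N ω) atTop) μ := by
    refine ⟨fun ω => liminf (fun N => (hEm N).mk _ ω) atTop,
      Measurable.liminf fun N => (hEm N).measurable_mk, ?_⟩
    filter_upwards [ae_all_iff.2 fun N => (hEm N).ae_eq_mk] with ω hω
    simp only [hω]
  -- The grid points below `t` converge to `t`, and `En N` bounds the squared increments up to them.
  refine ⟨fun ω => liminf (fun N => En N ω) atTop, hlim, fun ω t ht => ?_, ?_⟩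
  · obtain ⟨u, hu0, hu1, rfl⟩ : ∃ u : ℝ, 0 ≤ u ∧ u ≤ 1 ∧ a + (b - a) * u = t := by
      rcases hab.eq_or_lt with rfl | hlt
      · exact ⟨0, le_rfl, zero_le_one, by simpa using ht.1.antisymm ht.2⟩
      · have h0 := sub_pos.2 hlt
        refine ⟨(t - a) / (b - a), div_nonneg (sub_nonneg.2 ht.1) h0.le,
          (div_le_one h0).2 (by linarith [ht.2]), ?_⟩
        field_simp; ring
    have hfl : Tendsto (fun N : ℕ => (⌊u * (N : ℝ)⌋₊ : ℝ) / N) atTop (𝓝 u) :=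
      (tendsto_nat_floor_mul_div_atTop hu0).comp tendsto_natCast_atTop_atTop
    have hle : ∀ N : ℕ, ⌊u * (N : ℝ)⌋₊ ≤ N := fun N => by
      refine Nat.floor_le_of_le ?_
      calc u * (N : ℝ) ≤ 1 * N := by gcongr
        _ = N := one_mul _
    have hpt : Tendsto (fun N : ℕ => p N ⌊u * (N : ℝ)⌋₊) atTop
        (𝓝[Set.Icc a b] (a + (b - a) * u)) :=
      tendsto_nhdsWithin_iff.2 ⟨(hfl.const_mul _).const_add _,
        Eventually.of_forall fun N => hpmem N _ (hle N)⟩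
    have hlim : Tendsto (fun N : ℕ => ENNReal.ofReal ((Z (p N ⌊u * (N : ℝ)⌋₊) ω - Z a ω) ^ 2)) atTop
        (𝓝 (ENNReal.ofReal ((Z (a + (b - a) * u) ω - Z a ω) ^ 2))) :=
      ENNReal.tendsto_ofReal (((((hc ω) _ ht).tendsto.comp hpt).sub_const _).pow 2)
    rw [← hlim.liminf_eq]
    refine liminf_le_liminf (Eventually.of_forall fun N => ?_)
    have h := sq_sub_le_mul_sum_sq (fun i => Z (p N i) ω) (hle N)
    simp only [hp0] at h
    refine (ENNReal.ofReal_le_ofReal h).trans_eq ?_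
    rw [ENNReal.ofReal_mul (by positivity), ENNReal.ofReal_natCast,
      ENNReal.ofReal_sum_of_nonneg fun _ _ => sq_nonneg _]
  · refine (lintegral_liminf_le' hEm).trans ?_
    refine liminf_le_of_frequently_le' (Eventually.frequently ?_)
    filter_upwards [eventually_ne_atTop 0] with N hN using hEint N hN

/-- The supremum of a controlled family over `[a, b]`, in terms of its values at the `N` left ends
of a uniform grid. -/
lemma L2Control.lintegral_iSup_le {Z : ℝ → Ω → ℝ} {a b : ℝ} {v : ℝ → ℝ} (hab : a ≤ b)
    (hZ : L2Control μ Z (Set.Icc a b) v) (hm : ∀ t ∈ Set.Icc a b, AEMeasurable (Z t) μ)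
    (hc : ∀ ω, ContinuousOn (fun t => Z t ω) (Set.Icc a b)) (N : ℕ) :
    ∫⁻ ω, ⨆ t ∈ Set.Icc a b, ENNReal.ofReal (Z t ω ^ 2) ∂μ
      ≤ ∑ i ∈ Finset.range (N + 1), 2 * secondMoment μ (Z (a + (b - a) * (i / (N + 1 : ℕ))))
        + ENNReal.ofReal (2 * (b - a) / (N + 1 : ℕ) * (v b - v a)) := by
  set p : ℕ → ℝ := fun i => a + (b - a) * (i / (N + 1 : ℕ)) with hp
  have h0 : 0 ≤ b - a := sub_nonneg.2 hab
  have hmono : ∀ i j : ℕ, i ≤ j → p i ≤ p j := by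
    intro i j hij
    simp only [hp]; gcongr
  have hp0 : p 0 = a := by simp [hp]
  have hpN : p (N + 1) = b := by
    have : ((N + 1 : ℕ) : ℝ) ≠ 0 := by positivity
    simp only [hp]; rw [div_self this]; ring
  have hmem : ∀ i, i ≤ N + 1 → p i ∈ Set.Icc a b := fun i hi =>
    ⟨hp0 ▸ hmono 0 i (Nat.zero_le _), hpN ▸ hmono i _ hi⟩
  have hsub : ∀ i, i < N + 1 → Set.Icc (p i) (p (i + 1)) ⊆ Set.Icc a b := fun i hi =>
    Set.Icc_subset_Icc (hmem i hi.le).1 (hmem (i + 1) hi).2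
  have hex := fun i : ℕ => fun hi : i < N + 1 =>
    (hZ.subset (hsub i hi)).exists_maximal (hmono i (i + 1) (Nat.le_succ i))
    (fun t ht => hm t (hsub i hi ht)) (fun ω => (hc ω).mono (hsub i hi))
  choose! S hSm hSle hSint using hex
  have hpt : ∀ ω, ⨆ t ∈ Set.Icc a b, ENNReal.ofReal (Z t ω ^ 2)
      ≤ ∑ i ∈ Finset.range (N + 1), (2 * ENNReal.ofReal (Z (p i) ω ^ 2) + 2 * S i ω) := by
    intro ω
    refine iSup₂_le fun t ht => ?_
    obtain ⟨i, hi, hti⟩ : ∃ i < N + 1, t ∈ Set.Icc (p i) (p (i + 1)) := by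
      by_contra! hcon
      have : ∀ i, i ≤ N + 1 → p i ≤ t := by
        intro i
        induction i with
        | zero => intro _; rw [hp0]; exact ht.1
        | succ i ih =>
          intro hi
          by_contra! hlt
          exact hcon i hi ⟨ih (by omega), hlt.le⟩
      have hbt := this (N + 1) le_rfl
      exact hcon N (Nat.lt_succ_self N) ⟨this N (Nat.le_succ N), by rw [hpN]; exact ht.2⟩
    refine le_trans ?_ (Finset.single_le_sum
      (f := fun i => 2 * ENNReal.ofReal (Z (p i) ω ^ 2) + 2 * S i ω) (fun _ _ => zero_le)
      (Finset.mem_range.2 hi))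
    have h := ofReal_add_sq_le (Z (p i) ω) (Z t ω - Z (p i) ω)
    rw [add_sub_cancel] at h
    refine h.trans ?_
    gcongr
    exact hSle i hi ω t hti
  have hmeas : ∀ i < N + 1, AEMeasurable (fun ω => 2 * ENNReal.ofReal (Z (p i) ω ^ 2)) μ :=
    fun i hi => (hm _ (hmem i hi.le)).ofReal_sq.const_mul _
  have hd : ∀ i, p (i + 1) - p i = (b - a) / (N + 1 : ℕ) := fun i => by
    have : ((N + 1 : ℕ) : ℝ) ≠ 0 := by positivity
    simp only [hp]; rw [Nat.cast_succ i]; field_simp; ring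
  have hv : ∀ i ∈ Finset.range (N + 1), v (p i) ≤ v (p (i + 1)) := fun i hi => by
    have hi := Finset.mem_range.1 hi
    exact hZ.mono (hmem i hi.le) (hmem (i + 1) hi) (hmono i (i + 1) (Nat.le_succ i))
  calc _ ≤ ∫⁻ ω, ∑ i ∈ Finset.range (N + 1),
        (2 * ENNReal.ofReal (Z (p i) ω ^ 2) + 2 * S i ω) ∂μ := lintegral_mono hpt
    _ = ∑ i ∈ Finset.range (N + 1), (2 * secondMoment μ (Z (p i)) + 2 * ∫⁻ ω, S i ω ∂μ) := by
        rw [lintegral_finsetSum']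
        · refine Finset.sum_congr rfl fun i hi => ?_
          rw [lintegral_add_left' (hmeas i (Finset.mem_range.1 hi)),
            lintegral_const_mul' _ _ (by simp), lintegral_const_mul' _ _ (by simp)]
          rfl
        · intro i hi
          have hi := Finset.mem_range.1 hi
          exact (hmeas i hi).add ((hSm i hi).const_mul _)
    _ ≤ ∑ i ∈ Finset.range (N + 1), (2 * secondMoment μ (Z (p i))
        + ENNReal.ofReal (2 * (b - a) / (N + 1 : ℕ) * (v (p (i + 1)) - v (p i)))) := by
        refine Finset.sum_le_sum fun i hi => ?_
        gcongr
        have h2 : (2 : ℝ≥0∞) = ENNReal.ofReal 2 := by simp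
        rw [h2, mul_div_assoc, mul_assoc, ENNReal.ofReal_mul zero_le_two, ← hd i]
        gcongr
        exact hSint i (Finset.mem_range.1 hi)
    _ = _ := by
        rw [Finset.sum_add_distrib, ← ENNReal.ofReal_sum_of_nonneg, ← Finset.mul_sum
          (f := fun i => v (p (i + 1)) - v (p i)), Finset.sum_range_sub (fun j => v (p j)), hp0,
          hpN]
        intro i hi
        have := hv i hi
        exact mul_nonneg (by positivity) (sub_nonneg.2 this)

/-- If families are controlled on `[a, b]` uniformly in `m`, then convergence to zero in `L²` at
every parameter entails convergence to zero of the suprema over `[a, b]`. -/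
lemma tendsto_lintegral_iSup_zero {Z : ℕ → ℝ → Ω → ℝ} {a b L : ℝ} {v : ℕ → ℝ → ℝ} (hab : a ≤ b)
    (hZ : ∀ m, L2Control μ (Z m) (Set.Icc a b) (v m)) (hL : ∀ m, v m b - v m a ≤ L)
    (hm : ∀ m, ∀ t ∈ Set.Icc a b, AEMeasurable (Z m t) μ)
    (hc : ∀ m ω, ContinuousOn (fun t => Z m t ω) (Set.Icc a b))
    (hlim : ∀ t ∈ Set.Icc a b, Tendsto (fun m => secondMoment μ (Z m t)) atTop (𝓝 0)) :
    Tendsto (fun m => ∫⁻ ω, ⨆ t ∈ Set.Icc a b, ENNReal.ofReal (Z m t ω ^ 2) ∂μ) atTop (𝓝 0) := by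
  have h0 : 0 ≤ b - a := sub_nonneg.2 hab
  rw [ENNReal.tendsto_nhds_zero]
  intro ε hε
  have hgrid : Tendsto (fun N : ℕ => ENNReal.ofReal (2 * (b - a) / (N + 1 : ℕ) * L)) atTop
      (𝓝 0) := by
    have h := (tendsto_const_div_atTop_nhds_zero_nat (2 * (b - a) * L)).comp
      (tendsto_add_atTop_nat 1)
    have h' := ENNReal.tendsto_ofReal h
    rw [ENNReal.ofReal_zero] at h'
    refine h'.congr fun N => ?_
    simp only [Function.comp]
    congr 1; ring
  obtain ⟨N, hN⟩ := ((ENNReal.tendsto_nhds_zero.1 hgrid) (ε / 2) (ENNReal.half_pos hε.ne')).exists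
  have hsum : Tendsto (fun m => ∑ i ∈ Finset.range (N + 1),
      2 * secondMoment μ (Z m (a + (b - a) * (i / (N + 1 : ℕ))))) atTop (𝓝 0) := by
    have : Tendsto (fun m => ∑ i ∈ Finset.range (N + 1),
      2 * secondMoment μ (Z m (a + (b - a) * (i / (N + 1 : ℕ))))) atTop
      (𝓝 (∑ i ∈ Finset.range (N + 1), 2 * 0)) := by
      refine tendsto_finsetSum _ fun i hi => ENNReal.Tendsto.const_mul (hlim _ ?_) (by simp)
      have hi := Finset.mem_range.1 hi
      have h1 : (i : ℝ) / (N + 1 : ℕ) ≤ 1 :=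
        div_le_one_of_le₀ (by exact_mod_cast hi.le) (by positivity)
      have h2 : 0 ≤ (i : ℝ) / (N + 1 : ℕ) := by positivity
      exact ⟨by nlinarith, by nlinarith⟩
    simpa using this
  filter_upwards [(ENNReal.tendsto_nhds_zero.1 hsum) (ε / 2) (ENNReal.half_pos hε.ne')] with m hm'
  refine ((hZ m).lintegral_iSup_le hab (hm m) (hc m) N).trans ?_
  rw [← ENNReal.add_halves ε]
  refine add_le_add hm' (le_trans (ENNReal.ofReal_le_ofReal ?_) hN)
  gcongr
  exact hL m

end Increments

/-! ### The one-step optimization -/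

namespace SwingContract

section OneStep

variable (c : SwingContract) {k : ℕ}

/-- The least cumulative consumption at `t_{k+1}` that can be reached from `Q` at `t_k`. -/
def lowEnd (k : ℕ) (Q : ℝ) : ℝ := Q + max c.qmin (c.Qdown (k + 1) - Q)

/-- The greatest cumulative consumption at `t_{k+1}` that can be reached from `Q` at `t_k`. -/
def highEnd (k : ℕ) (Q : ℝ) : ℝ := Q + min c.qmax (c.Qup (k + 1) - Q)

/-- The optimal value `sup_q (q G + f (Q + q))` over the volumes `q` that may be bought at `t_k`,
for the continuation value `f`. -/
def stepValue (k : ℕ) (G : ℝ) (f : ℝ → ℝ) (Q : ℝ) : ℝ :=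
  sSup ((fun q => q * G + f (Q + q)) '' c.volumes k Q)

variable {c}

lemma mem_volumes_iff {Q q : ℝ} :
    q ∈ c.volumes k Q ↔ c.lowEnd k Q ≤ Q + q ∧ Q + q ≤ c.highEnd k Q := by
  simp [volumes, lowEnd, highEnd]

lemma add_mem_consumption {Q q : ℝ} (hq : q ∈ c.volumes k Q) : Q + q ∈ c.consumption (k + 1) := by
  have h1 := (le_max_right _ _).trans hq.1
  have h2 := hq.2.trans (min_le_right _ _)
  exact ⟨by linarith, by linarith⟩

lemma abs_le_of_mem_volumes {Q q : ℝ} (hq : q ∈ c.volumes k Q) : |q| ≤ |c.qmin| + |c.qmax| := by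
  have h1 := (le_max_left _ _).trans hq.1
  have h2 := hq.2.trans (min_le_left _ _)
  rw [abs_le]
  constructor
  · linarith [neg_abs_le c.qmin, abs_nonneg c.qmax]
  · linarith [le_abs_self c.qmax, abs_nonneg c.qmin]

lemma lowEnd_eq_max (Q : ℝ) : c.lowEnd k Q = max (Q + c.qmin) (c.Qdown (k + 1)) := by
  rw [lowEnd, ← max_add_add_left, add_sub_cancel]

lemma highEnd_eq_min (Q : ℝ) : c.highEnd k Q = min (Q + c.qmax) (c.Qup (k + 1)) := by
  rw [highEnd, ← min_add_add_left, add_sub_cancel]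

lemma lowEnd_mono : Monotone (c.lowEnd k) := fun Q Q' h => by
  simp only [lowEnd_eq_max]; gcongr

lemma highEnd_mono : Monotone (c.highEnd k) := fun Q Q' h => by
  simp only [highEnd_eq_min]; gcongr

lemma lowEnd_sub_le {Q Q' : ℝ} (h : Q ≤ Q') : c.lowEnd k Q' - c.lowEnd k Q ≤ Q' - Q := by
  have : max c.qmin (c.Qdown (k + 1) - Q') ≤ max c.qmin (c.Qdown (k + 1) - Q) := by gcongr
  simp only [lowEnd]; linarith

lemma highEnd_sub_le {Q Q' : ℝ} (h : Q ≤ Q') : c.highEnd k Q' - c.highEnd k Q ≤ Q' - Q := by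
  have : min c.qmax (c.Qup (k + 1) - Q') ≤ min c.qmax (c.Qup (k + 1) - Q) := by gcongr
  simp only [highEnd]; linarith

lemma lowEnd_le_highEnd {Q : ℝ} (hne : (c.volumes k Q).Nonempty) :
    c.lowEnd k Q ≤ c.highEnd k Q := by
  obtain ⟨q, hq⟩ := hne
  exact (mem_volumes_iff.1 hq).1.trans (mem_volumes_iff.1 hq).2

lemma sub_mem_volumes {Q R : ℝ} (h1 : c.lowEnd k Q ≤ R) (h2 : R ≤ c.highEnd k Q) :
    R - Q ∈ c.volumes k Q :=
  mem_volumes_iff.2 (by rw [add_sub_cancel]; exact ⟨h1, h2⟩)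

lemma lowEnd_mem {Q : ℝ} (hne : (c.volumes k Q).Nonempty) :
    c.lowEnd k Q ∈ c.consumption (k + 1) := by
  simpa using add_mem_consumption (sub_mem_volumes le_rfl (lowEnd_le_highEnd hne))

lemma highEnd_mem {Q : ℝ} (hne : (c.volumes k Q).Nonempty) :
    c.highEnd k Q ∈ c.consumption (k + 1) := by
  simpa using add_mem_consumption (sub_mem_volumes (lowEnd_le_highEnd hne) le_rfl)

lemma continuousOn_objective {f : ℝ → ℝ} (hf : ContinuousOn f (c.consumption (k + 1))) (G Q : ℝ) :
    ContinuousOn (fun q => q * G + f (Q + q)) (c.volumes k Q) :=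
  (continuous_id.mul continuous_const).continuousOn.add
    (hf.comp (continuous_const.add continuous_id).continuousOn fun _ hq => add_mem_consumption hq)

lemma isLUB_stepValue {f : ℝ → ℝ} (hf : ContinuousOn f (c.consumption (k + 1))) (G : ℝ) {Q : ℝ}
    (hne : (c.volumes k Q).Nonempty) :
    IsLUB ((fun q => q * G + f (Q + q)) '' c.volumes k Q) (c.stepValue k G f Q) :=
  isLUB_csSup (hne.image _)
    (isCompact_Icc.image_of_continuousOn (continuousOn_objective hf G Q)).bddAbove

lemma isLUB_stepValue_dense {f : ℝ → ℝ} (hf : ContinuousOn f (c.consumption (k + 1))) (G : ℝ)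
    {Q : ℝ} (hne : (c.volumes k Q).Nonempty) {D : Set ℝ} (hD : D ⊆ c.volumes k Q)
    (hD' : c.volumes k Q ⊆ closure D) :
    IsLUB ((fun q => q * G + f (Q + q)) '' D) (c.stepValue k G f Q) := by
  have h := isLUB_stepValue hf G hne
  refine ⟨fun y hy => h.1 (Set.image_mono hD hy), fun b hb => h.2 ?_⟩
  rintro _ ⟨q, hq, rfl⟩
  have hclosed : IsClosed (c.volumes k Q ∩ (fun q => q * G + f (Q + q)) ⁻¹' Set.Iic b) :=
    (continuousOn_objective hf G Q).preimage_isClosed_of_isClosed isClosed_Icc isClosed_Iic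
  have hDle : D ⊆ c.volumes k Q ∩ (fun q => q * G + f (Q + q)) ⁻¹' Set.Iic b := fun q hq =>
    ⟨hD hq, hb (Set.mem_image_of_mem _ hq)⟩
  exact (closure_minimal hDle hclosed (hD' hq)).2

lemma abs_stepValue_le {f : ℝ → ℝ} (hf : ContinuousOn f (c.consumption (k + 1))) (G : ℝ) {Q B : ℝ}
    (hne : (c.volumes k Q).Nonempty) (hB : ∀ R ∈ c.consumption (k + 1), |f R| ≤ B) :
    |c.stepValue k G f Q| ≤ |G| * (|c.qmin| + |c.qmax|) + B := by
  have h := isLUB_stepValue hf G hne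
  have hb : ∀ q ∈ c.volumes k Q, |q * G + f (Q + q)| ≤ |G| * (|c.qmin| + |c.qmax|) + B := by
    intro q hq
    refine (abs_add_le _ _).trans (add_le_add ?_ (hB _ (add_mem_consumption hq)))
    rw [abs_mul, mul_comm]
    gcongr
    exact abs_le_of_mem_volumes hq
  obtain ⟨q, hq⟩ := hne
  refine abs_le.2 ⟨(abs_le.1 (hb q hq)).1.trans (h.1 ⟨q, hq, rfl⟩), h.2 ?_⟩
  rintro _ ⟨q, hq, rfl⟩
  exact (abs_le.1 (hb q hq)).2

lemma abs_stepValue_sub_le {f f' : ℝ → ℝ} (hf : ContinuousOn f (c.consumption (k + 1)))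
    (hf' : ContinuousOn f' (c.consumption (k + 1))) (G : ℝ) {Q δ : ℝ}
    (hne : (c.volumes k Q).Nonempty) (hδ : ∀ R ∈ c.consumption (k + 1), |f R - f' R| ≤ δ) :
    |c.stepValue k G f Q - c.stepValue k G f' Q| ≤ δ := by
  have h := isLUB_stepValue hf G hne
  have h' := isLUB_stepValue hf' G hne
  have h1 : c.stepValue k G f Q ≤ c.stepValue k G f' Q + δ := by
    refine h.2 ?_
    rintro _ ⟨q, hq, rfl⟩
    have := h'.1 ⟨q, hq, rfl⟩
    have := (abs_le.1 (hδ _ (add_mem_consumption hq))).2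
    dsimp only at *; linarith
  have h2 : c.stepValue k G f' Q ≤ c.stepValue k G f Q + δ := by
    refine h'.2 ?_
    rintro _ ⟨q, hq, rfl⟩
    have := h.1 ⟨q, hq, rfl⟩
    have := (abs_le.1 (hδ _ (add_mem_consumption hq))).1
    dsimp only at *; linarith
  exact abs_le.2 ⟨by linarith, by linarith⟩

/-- Increments of the optimal value. When `Q` grows to `Q'`, the interval of reachable levels moves
up with both ends, so a level in one interval is either in the other one as well or between two
corresponding ends: only the oscillations of `f` between the old and the new ends matter. -/
lemma abs_stepValue_increment_le {f : ℝ → ℝ} (hf : ContinuousOn f (c.consumption (k + 1)))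
    (G : ℝ) {Q Q' s s' : ℝ} (hQ : Q ≤ Q') (hne : (c.volumes k Q).Nonempty)
    (hne' : (c.volumes k Q').Nonempty)
    (hs : ∀ t ∈ Set.Icc (c.lowEnd k Q) (c.lowEnd k Q'), |f t - f (c.lowEnd k Q)| ≤ s)
    (hs' : ∀ t ∈ Set.Icc (c.highEnd k Q) (c.highEnd k Q'), |f t - f (c.highEnd k Q)| ≤ s') :
    |c.stepValue k G f Q' - c.stepValue k G f Q| ≤ |G| * (Q' - Q) + 2 * s + s' := by
  have h := isLUB_stepValue hf G hne
  have h' := isLUB_stepValue hf G hne'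
  have hlow := lowEnd_mono (c := c) (k := k) hQ
  have hhigh := highEnd_mono (c := c) (k := k) hQ
  have hlow' := lowEnd_sub_le (c := c) (k := k) hQ
  have hhigh' := highEnd_sub_le (c := c) (k := k) hQ
  have hle := lowEnd_le_highEnd hne
  have hle' := lowEnd_le_highEnd hne'
  have hs0 : 0 ≤ s := (abs_nonneg _).trans (hs _ ⟨le_rfl, hlow⟩)
  have hs0' : 0 ≤ s' := (abs_nonneg _).trans (hs' _ ⟨le_rfl, hhigh⟩)
  -- The effect on the linear term of moving the volume by at most `Q' - Q`
  have hlin : ∀ d, |d| ≤ Q' - Q → d * G ≤ |G| * (Q' - Q) := fun d hd => by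
    calc d * G ≤ |d * G| := le_abs_self _
      _ = |G| * |d| := by rw [abs_mul, mul_comm]
      _ ≤ _ := by gcongr
  have hd0 : |Q' - Q| ≤ Q' - Q := (abs_of_nonneg (sub_nonneg.2 hQ)).le
  have hd0' : |-(Q' - Q)| ≤ Q' - Q := by rwa [abs_neg]
  have h1 : c.stepValue k G f Q ≤ c.stepValue k G f Q' + (|G| * (Q' - Q) + 2 * s + s') := by
    refine h.2 ?_
    rintro _ ⟨q, hq, rfl⟩
    have hR := mem_volumes_iff.1 hq
    dsimp only
    -- A level below the new interval is replaced by the new lower end.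
    rcases le_total (c.lowEnd k Q') (Q + q) with hc | hc
    · have := h'.1 ⟨_, sub_mem_volumes hc (hR.2.trans hhigh), rfl⟩
      have := hlin _ hd0
      dsimp only at *; rw [add_sub_cancel] at *; nlinarith
    · have := h'.1 ⟨_, sub_mem_volumes le_rfl hle', rfl⟩
      have h3 := abs_le.1 (hs _ ⟨hR.1, hc⟩)
      have h4 := abs_le.1 (hs _ ⟨hlow, le_rfl⟩)
      have := hlin (q - (c.lowEnd k Q' - Q')) (abs_le.2 ⟨by linarith, by linarith⟩)
      dsimp only at *; rw [add_sub_cancel] at *; nlinarith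
  have h2 : c.stepValue k G f Q' ≤ c.stepValue k G f Q + (|G| * (Q' - Q) + 2 * s + s') := by
    refine h'.2 ?_
    rintro _ ⟨q, hq, rfl⟩
    have hR := mem_volumes_iff.1 hq
    dsimp only
    -- A level above the old interval is replaced by the old upper end.
    rcases le_total (Q' + q) (c.highEnd k Q) with hc | hc
    · have := h.1 ⟨_, sub_mem_volumes (hlow.trans hR.1) hc, rfl⟩
      have := hlin _ hd0'
      dsimp only at *; rw [add_sub_cancel] at *; nlinarith
    · have := h.1 ⟨_, sub_mem_volumes hle le_rfl, rfl⟩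
      have h3 := abs_le.1 (hs' _ ⟨hc, hR.2⟩)
      have := hlin (q - (c.highEnd k Q - Q)) (abs_le.2 ⟨by linarith, by linarith⟩)
      dsimp only at *; rw [add_sub_cancel] at *; nlinarith
  exact abs_le.2 ⟨by linarith, by linarith⟩

lemma abs_stepValue_increment_le_of_lipschitz {f : ℝ → ℝ} {ℓ : ℝ} (hℓ : 0 ≤ ℓ)
    (hf : ContinuousOn f (c.consumption (k + 1)))
    (hlip : ∀ R ∈ c.consumption (k + 1), ∀ R' ∈ c.consumption (k + 1), |f R' - f R| ≤ ℓ * |R' - R|)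
    (G : ℝ) {Q Q' : ℝ} (hne : (c.volumes k Q).Nonempty)
    (hne' : (c.volumes k Q').Nonempty) :
    |c.stepValue k G f Q' - c.stepValue k G f Q| ≤ (|G| + 3 * ℓ) * |Q' - Q| := by
  wlog hQ : Q ≤ Q' generalizing Q Q'
  · rw [abs_sub_comm, abs_sub_comm Q']
    exact this hne' hne (le_of_not_ge hQ)
  have hord : (c.consumption (k + 1)).OrdConnected := Set.ordConnected_Icc
  have key : ∀ a ∈ c.consumption (k + 1), ∀ b ∈ c.consumption (k + 1), b - a ≤ Q' - Q →
      ∀ t ∈ Set.Icc a b, |f t - f a| ≤ ℓ * (Q' - Q) := by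
    intro a ha b hb hab t ht
    refine (hlip a ha t (hord.out ha hb ht)).trans ?_
    rw [abs_of_nonneg (sub_nonneg.2 ht.1)]
    exact mul_le_mul_of_nonneg_left (by linarith [ht.2]) hℓ
  have h := abs_stepValue_increment_le hf G hQ hne hne'
    (key _ (lowEnd_mem hne) _ (lowEnd_mem hne') (lowEnd_sub_le hQ))
    (key _ (highEnd_mem hne) _ (highEnd_mem hne') (highEnd_sub_le hQ))
  rw [abs_of_nonneg (sub_nonneg.2 hQ)]
  linarith

section Measurability

variable {α : Type*} [MeasurableSpace α]

lemma exists_countable_dense_volumes (Q : ℝ) :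
    ∃ D ⊆ c.volumes k Q, D.Countable ∧ c.volumes k Q ⊆ closure D :=
  (TopologicalSpace.IsSeparable.of_separableSpace _).exists_countable_dense_subset

lemma measurable_stepValue {G : α → ℝ} (hG : Measurable G) {F : ℝ → α → ℝ}
    (hF : ∀ R ∈ c.consumption (k + 1), Measurable (F R))
    (hc : ∀ x, ContinuousOn (fun R => F R x) (c.consumption (k + 1))) {Q : ℝ}
    (hne : (c.volumes k Q).Nonempty) :
    Measurable (fun x => c.stepValue k (G x) (fun R => F R x) Q) := by
  obtain ⟨D, hD, hcount, hD'⟩ := exists_countable_dense_volumes (c := c) (k := k) Q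
  have := hcount.to_subtype
  refine Measurable.isLUB (f := fun (q : D) x => (q : ℝ) * G x + F (Q + q) x)
    (fun q => (hG.const_mul _).add (hF _ (add_mem_consumption (hD q.2)))) fun x => ?_
  have h := isLUB_stepValue_dense (hc x) (G x) hne hD hD'
  rw [Set.image_eq_range] at h
  exact h

variable {E : Type*} [MeasurableSpace E]

/-- The pointwise supremum over the volumes is an essential supremum over the admissible controls:
it dominates every control, and the constant controls from a countable dense set of volumes
suffice to reach it. -/
lemma isEssSup_stepValue (μ : Measure α) (X : ℕ → α → E) {G : α → ℝ} (hG : Measurable G)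
    {F : ℝ → α → ℝ} (hF : ∀ R ∈ c.consumption (k + 1), Measurable (F R))
    (hc : ∀ x, ContinuousOn (fun R => F R x) (c.consumption (k + 1))) {Q : ℝ}
    (hne : (c.volumes k Q).Nonempty) :
    IsEssSup μ ((fun (q : α → ℝ) (x : α) => q x * G x + F (Q + q x) x) '' c.adm μ X k Q)
      (fun x => c.stepValue k (G x) (fun R => F R x) Q) := by
  refine ⟨measurable_stepValue hG hF hc hne, ?_, fun Z' hZ' hle => ?_⟩
  · rintro _ ⟨q, hq, rfl⟩
    exact Eventually.of_forall fun x => (isLUB_stepValue (hc x) (G x) hne).1 ⟨q x, hq.2 x, rfl⟩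
  · obtain ⟨D, hD, hcount, hD'⟩ := exists_countable_dense_volumes (c := c) (k := k) Q
    have hall : ∀ᵐ x ∂μ, ∀ q ∈ D, q * G x + F (Q + q) x ≤ Z' x :=
      (ae_ball_iff hcount).2 fun q hq =>
        hle _ ⟨fun _ => q, ⟨aestronglyMeasurable_const, fun _ => hD hq⟩, rfl⟩
    filter_upwards [hall] with x hx
    refine (isLUB_stepValue_dense (hc x) (G x) hne hD hD').2 ?_
    rintro _ ⟨q, hq, rfl⟩
    exact hx q hq

lemma essSupFamily_ae_eq {μ : Measure α} {S : Set (α → ℝ)} {Z : α → ℝ} (hZ : IsEssSup μ S Z) :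
    essSupFamily μ S =ᵐ[μ] Z := by
  have h : ∃ Z, IsEssSup μ S Z := ⟨Z, hZ⟩
  have hc := h.choose_spec
  rw [essSupFamily, dif_pos h]
  filter_upwards [hc.2.2 Z hZ.1 hZ.2.1, hZ.2.2 _ hc.1 hc.2.1] with x h1 h2 using le_antisymm h1 h2

/-- The one-step optimization preserves control of the increments: by the maximal inequality the
oscillations of `F` between the old and the new ends are controlled by the increments of `v`
along both ends. -/
lemma L2Control_stepValue {μ : Measure α} {G : α → ℝ} (hG : MemLp G 2 μ)
    {F : ℝ → α → ℝ} (hF : ∀ R ∈ c.consumption (k + 1), Measurable (F R))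
    (hc : ∀ x, ContinuousOn (fun R => F R x) (c.consumption (k + 1)))
    (hne : ∀ Q ∈ c.consumption k, (c.volumes k Q).Nonempty) {v : ℝ → ℝ}
    (hv : L2Control μ F (c.consumption (k + 1)) v) :
    L2Control μ (fun Q x => c.stepValue k (G x) (fun R => F R x) Q) (c.consumption k)
      (fun Q => 3 * (secondMoment μ G).toReal * Q + 12 * v (c.lowEnd k Q)
        + 3 * v (c.highEnd k Q)) := by
  have hvl : ∀ Q ∈ c.consumption k, ∀ Q' ∈ c.consumption k, Q ≤ Q' →
      v (c.lowEnd k Q) ≤ v (c.lowEnd k Q') := fun Q h Q' h' hle =>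
    hv.mono (lowEnd_mem (hne Q h)) (lowEnd_mem (hne Q' h')) (lowEnd_mono hle)
  have hvh : ∀ Q ∈ c.consumption k, ∀ Q' ∈ c.consumption k, Q ≤ Q' →
      v (c.highEnd k Q) ≤ v (c.highEnd k Q') := fun Q h Q' h' hle =>
    hv.mono (highEnd_mem (hne Q h)) (highEnd_mem (hne Q' h')) (highEnd_mono hle)
  refine ⟨fun Q h Q' h' hle => ?_, fun Q h Q' h' hle => ?_⟩
  · have := hvl Q h Q' h' hle
    have := hvh Q h Q' h' hle
    have : 3 * (secondMoment μ G).toReal * Q ≤ 3 * (secondMoment μ G).toReal * Q' := by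
      gcongr
    linarith
  have hsl : Set.Icc (c.lowEnd k Q) (c.lowEnd k Q') ⊆ c.consumption (k + 1) :=
    Set.Icc_subset_Icc (lowEnd_mem (hne Q h)).1 (lowEnd_mem (hne Q' h')).2
  have hsh : Set.Icc (c.highEnd k Q) (c.highEnd k Q') ⊆ c.consumption (k + 1) :=
    Set.Icc_subset_Icc (highEnd_mem (hne Q h)).1 (highEnd_mem (hne Q' h')).2
  obtain ⟨S, hSm, hS, hSint⟩ := (hv.subset hsl).exists_maximal (lowEnd_mono hle)
    (fun t ht => (hF t (hsl ht)).aemeasurable) (fun x => (hc x).mono hsl)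
  obtain ⟨S', hSm', hS', hSint'⟩ := (hv.subset hsh).exists_maximal (highEnd_mono hle)
    (fun t ht => (hF t (hsh ht)).aemeasurable) (fun x => (hc x).mono hsh)
  have h0 : 0 ≤ Q' - Q := sub_nonneg.2 hle
  have hpt : ∀ x, ENNReal.ofReal ((c.stepValue k (G x) (fun R => F R x) Q'
      - c.stepValue k (G x) (fun R => F R x) Q) ^ 2)
      ≤ (ENNReal.ofReal (3 * (Q' - Q) ^ 2) * ENNReal.ofReal (G x ^ 2) + 12 * S x) + 3 * S' x := by
    intro x
    by_cases hSx : S x = ∞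
    · simp [hSx]
    by_cases hSx' : S' x = ∞
    · simp [hSx']
    have hroot : ∀ {u : ℝ} {w : ℝ≥0∞}, w ≠ ∞ → ENNReal.ofReal (u ^ 2) ≤ w →
        |u| ≤ √w.toReal := fun {u w} hw hu =>
      Real.abs_le_sqrt ((ENNReal.ofReal_le_iff_le_toReal hw).1 hu)
    have hinc := abs_stepValue_increment_le (hc x) (G x) hle (hne Q h) (hne Q' h')
      (fun t ht => hroot hSx (hS x t ht)) (fun t ht => hroot hSx' (hS' x t ht))
    have e1 := Real.sq_sqrt (ENNReal.toReal_nonneg (a := S x))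
    have e2 := Real.sq_sqrt (ENNReal.toReal_nonneg (a := S' x))
    set a := √(S x).toReal
    set b := √(S' x).toReal
    have h12 : (12 : ℝ≥0∞) = ENNReal.ofReal 12 := by simp
    have h3 : (3 : ℝ≥0∞) = ENNReal.ofReal 3 := by simp
    rw [← ENNReal.ofReal_toReal hSx, ← ENNReal.ofReal_toReal hSx', h12, h3,
      ← ENNReal.ofReal_mul (by positivity), ← ENNReal.ofReal_mul (by positivity),
      ← ENNReal.ofReal_mul (by positivity), ← ENNReal.ofReal_add (by positivity) (by positivity),
      ← ENNReal.ofReal_add (by positivity) (by positivity), ← e1, ← e2]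
    refine ENNReal.ofReal_le_ofReal ?_
    rw [← sq_abs, ← sq_abs (G x)]
    refine (pow_le_pow_left₀ (abs_nonneg _) hinc 2).trans ?_
    nlinarith [sq_nonneg (|G x| * (Q' - Q) - 2 * a), sq_nonneg (|G x| * (Q' - Q) - b),
      sq_nonneg (2 * a - b)]
  calc secondMoment μ _
      ≤ ∫⁻ x, ((ENNReal.ofReal (3 * (Q' - Q) ^ 2) * ENNReal.ofReal (G x ^ 2) + 12 * S x)
          + 3 * S' x) ∂μ := lintegral_mono hpt
    _ = ENNReal.ofReal (3 * (Q' - Q) ^ 2) * secondMoment μ G + 12 * ∫⁻ x, S x ∂μ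
          + 3 * ∫⁻ x, S' x ∂μ := by
        rw [lintegral_add_right' _ (hSm'.const_mul _), lintegral_add_right' _ (hSm.const_mul _),
          lintegral_const_mul' _ _ ENNReal.ofReal_ne_top,
          lintegral_const_mul' _ _ (by simp), lintegral_const_mul' _ _ (by simp)]
        rfl
    _ ≤ ENNReal.ofReal (3 * (Q' - Q) ^ 2) * ENNReal.ofReal (secondMoment μ G).toReal
          + ENNReal.ofReal 12 * ENNReal.ofReal ((Q' - Q) * (v (c.lowEnd k Q') - v (c.lowEnd k Q)))
          + ENNReal.ofReal 3
            * ENNReal.ofReal ((Q' - Q) * (v (c.highEnd k Q') - v (c.highEnd k Q))) := by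
        rw [← secondMoment_eq_ofReal hG]
        have h12 : ENNReal.ofReal 12 = 12 := by simp
        have h3 : ENNReal.ofReal 3 = 3 := by simp
        rw [h12, h3]
        gcongr
        · refine hSint.trans (ENNReal.ofReal_le_ofReal ?_)
          exact mul_le_mul_of_nonneg_right (lowEnd_sub_le hle)
            (sub_nonneg.2 (hvl Q h Q' h' hle))
        · refine hSint'.trans (ENNReal.ofReal_le_ofReal ?_)
          exact mul_le_mul_of_nonneg_right (highEnd_sub_le hle)
            (sub_nonneg.2 (hvh Q h Q' h' hle))
    _ = _ := by
        have hl := sub_nonneg.2 (hvl Q h Q' h' hle)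
        have hh := sub_nonneg.2 (hvh Q h Q' h' hle)
        rw [← ENNReal.ofReal_mul (by positivity), ← ENNReal.ofReal_mul (by positivity),
          ← ENNReal.ofReal_mul (by positivity), ← ENNReal.ofReal_add (by positivity)
          (by positivity), ← ENNReal.ofReal_add (by positivity) (by positivity)]
        congr 1; ring

end Measurability

end OneStep

end SwingContract

/-! ### Least-squares regression -/

section SquareIntegrable

variable {Ω : Type*} [MeasurableSpace Ω] {μ : Measure Ω}

lemma inner_toLp_toLp {f g : Ω → ℝ} (hf : MemLp f 2 μ) (hg : MemLp g 2 μ) :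
    inner ℝ (hf.toLp f) (hg.toLp g) = ∫ ω, f ω * g ω ∂μ := by
  rw [L2.inner_def]
  refine integral_congr_ae ?_
  filter_upwards [hf.coeFn_toLp, hg.coeFn_toLp] with ω h1 h2
  rw [h1, h2]
  simp [mul_comm]

lemma norm_toLp_sq {f : Ω → ℝ} (hf : MemLp f 2 μ) :
    ‖hf.toLp f‖ ^ 2 = (secondMoment μ f).toReal := by
  rw [Lp.norm_toLp, ← eLpNorm_two_sq, ENNReal.toReal_pow]

lemma secondMoment_eq_ofReal_norm {f : Ω → ℝ} (hf : MemLp f 2 μ) :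
    secondMoment μ f = ENNReal.ofReal (‖hf.toLp f‖ ^ 2) := by
  rw [norm_toLp_sq, ← secondMoment_eq_ofReal hf]

lemma sq_integral_mul_le {f g : Ω → ℝ} (hf : MemLp f 2 μ) (hg : MemLp g 2 μ) :
    (∫ ω, f ω * g ω ∂μ) ^ 2 ≤ (secondMoment μ f).toReal * (secondMoment μ g).toReal := by
  rw [← inner_toLp_toLp hf hg, ← norm_toLp_sq hf, ← norm_toLp_sq hg, ← mul_pow, ← sq_abs]
  gcongr
  exact abs_real_inner_le_norm _ _

/-- A controlled family is continuous in `L²`, hence so are its moments against a fixed square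
integrable variable. -/
lemma L2Control.continuousOn_integral_mul {Z : ℝ → Ω → ℝ} {a b : ℝ} {v : ℝ → ℝ}
    (hZ : L2Control μ Z (Set.Icc a b) v) (hm : ∀ t ∈ Set.Icc a b, MemLp (Z t) 2 μ) {f : Ω → ℝ}
    (hf : MemLp f 2 μ) : ContinuousOn (fun t => ∫ ω, Z t ω * f ω ∂μ) (Set.Icc a b) := by
  set C := (v b - v a) * (secondMoment μ f).toReal
  have key : ∀ r ∈ Set.Icc a b, ∀ t ∈ Set.Icc a b,
      (∫ ω, Z t ω * f ω ∂μ - ∫ ω, Z r ω * f ω ∂μ) ^ 2 ≤ |t - r| * C := by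
    intro r hr t ht
    wlog hrt : r ≤ t generalizing r t
    · rw [abs_sub_comm, ← neg_sub, neg_sq]
      exact this t ht r hr (le_of_not_ge hrt)
    have hab : a ≤ b := hr.1.trans hr.2
    have hinc := hZ.incr r hr t ht hrt
    have hvt := hZ.mono ht (Set.right_mem_Icc.2 hab) ht.2
    have hvr := hZ.mono (Set.left_mem_Icc.2 hab) hr hr.1
    have hvrt := hZ.mono hr ht hrt
    have hsub : ∫ ω, Z t ω * f ω ∂μ - ∫ ω, Z r ω * f ω ∂μ = ∫ ω, (Z t ω - Z r ω) * f ω ∂μ := by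
      refine (integral_sub ((hm t ht).integrable_mul hf)
        ((hm r hr).integrable_mul hf)).symm.trans ?_
      exact integral_congr_ae (Eventually.of_forall fun ω => (sub_mul _ _ _).symm)
    rw [hsub, abs_of_nonneg (sub_nonneg.2 hrt)]
    refine (sq_integral_mul_le ((hm t ht).sub (hm r hr)) hf).trans ?_
    rw [← mul_assoc]
    gcongr
    refine ENNReal.toReal_le_of_le_ofReal (mul_nonneg (sub_nonneg.2 hrt) (by linarith)) ?_
    refine hinc.trans (ENNReal.ofReal_le_ofReal ?_)
    exact mul_le_mul_of_nonneg_left (by linarith) (sub_nonneg.2 hrt)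
  intro r hr
  have hlim : Tendsto (fun t => √(|t - r| * C)) (𝓝[Set.Icc a b] r) (𝓝 0) := by
    have : Continuous fun t => √(|t - r| * C) := by fun_prop
    have h := (this.tendsto r).mono_left (nhdsWithin_le_nhds (s := Set.Icc a b))
    simpa using h
  refine tendsto_iff_dist_tendsto_zero.2 (squeeze_zero' (Eventually.of_forall fun _ => dist_nonneg)
    ?_ hlim)
  filter_upwards [self_mem_nhdsWithin] with t ht
  rw [Real.dist_eq]
  exact Real.abs_le_sqrt (key r hr t ht)

end SquareIntegrable

/-- The span of the first `m` members of a sequence in a Hilbert space. -/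
def initialSpan {H : Type*} [NormedAddCommGroup H] [InnerProductSpace ℝ H] (v : ℕ → H) (m : ℕ) :
    Submodule ℝ H :=
  Submodule.span ℝ (Set.range fun i : Fin m => v i)

instance {H : Type*} [NormedAddCommGroup H] [InnerProductSpace ℝ H] (v : ℕ → H) (m : ℕ) :
    (initialSpan v m).HasOrthogonalProjection := by
  have : FiniteDimensional ℝ (initialSpan v m) :=
    FiniteDimensional.span_of_finite ℝ (Set.finite_range _)
  infer_instance

namespace SwingContract

section Regression

variable {Ω E : Type*} [MeasurableSpace Ω] {μ : Measure Ω} {X : ℕ → Ω → E} {e : ℕ → E → ℝ} {m k : ℕ}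

/-- The least-squares regression `⟨(A_m^k)⁻¹ 𝔼(Y e^m(X_{t_k})), e^m(X_{t_k})⟩` of `Y`. -/
def regression (μ : Measure Ω) (X : ℕ → Ω → E) (e : ℕ → E → ℝ) (m k : ℕ) (Y : Ω → ℝ) (ω : Ω) : ℝ :=
  ∑ i : Fin m, lsCoeff μ X e m k Y i * e i (X k ω)

lemma memLp_regression (he : ∀ i, MemLp (fun ω => e i (X k ω)) 2 μ) (Y : Ω → ℝ) :
    MemLp (regression μ X e m k Y) 2 μ :=
  memLp_finsetSum _ fun i _ => (he i).const_mul _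

lemma regression_sub (he : ∀ i, MemLp (fun ω => e i (X k ω)) 2 μ) {Y Y' : Ω → ℝ}
    (hY : MemLp Y 2 μ) (hY' : MemLp Y' 2 μ) (ω : Ω) :
    regression μ X e m k (fun ω => Y ω - Y' ω) ω
      = regression μ X e m k Y ω - regression μ X e m k Y' ω := by
  have h : lsCoeff μ X e m k (fun ω => Y ω - Y' ω)
      = lsCoeff μ X e m k Y - lsCoeff μ X e m k Y' := by
    unfold lsCoeff
    rw [← Matrix.mulVec_sub]
    congr 1
    funext i
    simp only [Pi.sub_apply]
    refine Eq.trans ?_ (integral_sub (hY.integrable_mul (he i)) (hY'.integrable_mul (he i)))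
    exact integral_congr_ae (Eventually.of_forall fun ω => sub_mul _ _ _)
  simp only [regression, h, Pi.sub_apply, sub_mul, Finset.sum_sub_distrib]

/-- The regression is the orthogonal projection onto the span of the regression variables. -/
lemma toLp_regression (he : ∀ i, MemLp (fun ω => e i (X k ω)) 2 μ)
    (hind : LinearIndependent ℝ fun i : ℕ => (he i).toLp) {Y : Ω → ℝ} (hY : MemLp Y 2 μ) :
    (memLp_regression (m := m) he Y).toLp
      = (initialSpan (fun i : ℕ => (he i).toLp) m).starProjection hY.toLp := by
  set v : Fin m → Lp ℝ 2 μ := fun i => (he i).toLp with hv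
  set θ := lsCoeff μ X e m k Y with hθ
  have hgram : gram μ X e m k = Matrix.gram ℝ v := by
    ext i j
    simp only [gram, Matrix.of_apply, Matrix.gram_apply, hv, inner_toLp_toLp]
  have hdet : IsUnit (gram μ X e m k).det := by
    rw [hgram, isUnit_iff_ne_zero, Matrix.det_gram_ne_zero_iff_linearIndependent]
    exact hind.comp _ Fin.val_injective
  have hsum : (memLp_regression (m := m) he Y).toLp = ∑ i, θ i • v i := by
    apply Lp.ext
    have h1 : ∀ᵐ ω ∂μ, ∀ i : Fin m, v i ω = e i (X k ω) :=
      ae_all_iff.2 fun i => (he i).coeFn_toLp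
    have h2 : ∀ᵐ ω ∂μ, ∀ i : Fin m, (θ i • v i : Lp ℝ 2 μ) ω = θ i * v i ω :=
      ae_all_iff.2 fun i => Lp.coeFn_smul _ _
    filter_upwards [(memLp_regression (m := m) he Y).coeFn_toLp, h1, h2,
      Lp.coeFn_finsetSum Finset.univ (fun i => θ i • v i)] with ω h3 h4 h5 h6
    rw [h3, h6, Finset.sum_apply, regression]
    exact Finset.sum_congr rfl fun i _ => by rw [h5, h4]
  have hnormal : ∀ j, inner ℝ (hY.toLp - ∑ i, θ i • v i) (v j) = 0 := by
    intro j
    have hmul : (gram μ X e m k).mulVec θ = fun i : Fin m => ∫ ω, Y ω * e i (X k ω) ∂μ := by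
      rw [hθ, lsCoeff, Matrix.mulVec_mulVec, Matrix.mul_nonsing_inv _ hdet, Matrix.one_mulVec]
    have hj := congrFun hmul j
    rw [hgram] at hj
    rw [inner_sub_left, sum_inner, inner_toLp_toLp, ← hj, sub_eq_zero, Matrix.mulVec, dotProduct]
    refine Finset.sum_congr rfl fun i _ => ?_
    rw [real_inner_smul_left, Matrix.gram_apply, real_inner_comm, mul_comm]
  rw [hsum]
  symm
  refine Submodule.eq_starProjection_of_mem_of_inner_eq_zero
    (Submodule.sum_mem _ fun i _ => Submodule.smul_mem _ _
      (Submodule.subset_span (Set.mem_range_self i))) ?_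
  intro w hw
  induction hw using Submodule.span_induction with
  | mem x hx => obtain ⟨j, rfl⟩ := hx; exact hnormal j
  | zero => exact inner_zero_right _
  | add x y _ _ hx hy => rw [inner_add_right, hx, hy, add_zero]
  | smul a x _ hx => rw [real_inner_smul_right, hx, mul_zero]

lemma secondMoment_regression_le (he : ∀ i, MemLp (fun ω => e i (X k ω)) 2 μ)
    (hind : LinearIndependent ℝ fun i : ℕ => (he i).toLp) {Y : Ω → ℝ} (hY : MemLp Y 2 μ) :
    secondMoment μ (regression μ X e m k Y) ≤ secondMoment μ Y := by
  rw [secondMoment_eq_ofReal_norm hY, secondMoment_eq_ofReal_norm (memLp_regression he Y),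
    toLp_regression he hind hY]
  gcongr
  exact Submodule.norm_starProjection_apply_le _ _

lemma L2Control_regression (he : ∀ i, MemLp (fun ω => e i (X k ω)) 2 μ)
    (hind : LinearIndependent ℝ fun i : ℕ => (he i).toLp) {Z : ℝ → Ω → ℝ} {s : Set ℝ} {v : ℝ → ℝ}
    (hZ : L2Control μ Z s v) (hm : ∀ t ∈ s, MemLp (Z t) 2 μ) :
    L2Control μ (fun t => regression μ X e m k (Z t)) s v := by
  refine ⟨hZ.mono, fun r hr t ht hrt => le_trans ?_ (hZ.incr r hr t ht hrt)⟩
  simp only [← regression_sub he (hm t ht) (hm r hr)]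
  exact secondMoment_regression_le he hind ((hm t ht).sub (hm r hr))

lemma continuousOn_lsCoeff (he : ∀ i, MemLp (fun ω => e i (X k ω)) 2 μ) {Z : ℝ → Ω → ℝ} {a b : ℝ}
    {v : ℝ → ℝ} (hZ : L2Control μ Z (Set.Icc a b) v) (hm : ∀ t ∈ Set.Icc a b, MemLp (Z t) 2 μ) :
    ContinuousOn (fun t => lsCoeff μ X e m k (Z t)) (Set.Icc a b) := by
  have h : ContinuousOn (fun t => fun i : Fin m => ∫ ω, Z t ω * e i (X k ω) ∂μ) (Set.Icc a b) :=
    continuousOn_pi.2 fun i => hZ.continuousOn_integral_mul hm (he i)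
  exact (Continuous.matrix_mulVec continuous_const continuous_id).comp_continuousOn h

lemma continuousOn_regression (he : ∀ i, MemLp (fun ω => e i (X k ω)) 2 μ) {Z : ℝ → Ω → ℝ} {a b : ℝ}
    {v : ℝ → ℝ} (hZ : L2Control μ Z (Set.Icc a b) v) (hm : ∀ t ∈ Set.Icc a b, MemLp (Z t) 2 μ)
    (ω : Ω) : ContinuousOn (fun t => regression μ X e m k (Z t) ω) (Set.Icc a b) :=
  continuousOn_finsetSum _ fun i _ =>
    (continuousOn_pi.1 (continuousOn_lsCoeff he hZ hm) i).mul continuousOn_const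

/-- If the regression functions are total, then the regression converges to the conditional
expectation given `X_{t_k}`. -/
lemma tendsto_secondMoment_regression_sub_condExp [MeasurableSpace E] [IsFiniteMeasure μ]
    (hX : Measurable (X k)) (he : ∀ i, MemLp (fun ω => e i (X k ω)) 2 μ)
    (hind : LinearIndependent ℝ fun i : ℕ => (he i).toLp)
    (htotal : (Submodule.span ℝ (Set.range fun i : ℕ => (he i).toLp)).topologicalClosure
      = lpMeas ℝ ℝ (MeasurableSpace.comap (X k) inferInstance) 2 μ) {Y : Ω → ℝ} (hY : MemLp Y 2 μ) :
    Tendsto (fun m => secondMoment μ (fun ω => regression μ X e m k Y ω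
      - (μ[Y | MeasurableSpace.comap (X k) inferInstance]) ω)) atTop (𝓝 0) := by
  set v : ℕ → Lp ℝ 2 μ := fun i => (he i).toLp with hv
  have hUmono : Monotone (initialSpan v) := by
    intro m m' hm
    refine Submodule.span_mono ?_
    rintro _ ⟨i, rfl⟩
    exact ⟨Fin.castLE hm i, rfl⟩
  have hUsup : (⨆ m, initialSpan v m) = Submodule.span ℝ (Set.range v) := by
    refine le_antisymm (iSup_le fun m => Submodule.span_mono ?_) (Submodule.span_le.2 ?_)
    · rintro _ ⟨i, rfl⟩
      exact ⟨i, rfl⟩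
    · rintro _ ⟨i, rfl⟩
      exact Submodule.mem_iSup_of_mem (i + 1)
        (Submodule.subset_span ⟨⟨i, Nat.lt_succ_self i⟩, rfl⟩)
  have hle : MeasurableSpace.comap (X k) inferInstance ≤ (inferInstance : MeasurableSpace Ω) :=
    hX.comap_le
  have hcl : (⨆ m, initialSpan v m).topologicalClosure
      = lpMeas ℝ ℝ (MeasurableSpace.comap (X k) inferInstance) 2 μ := by rw [hUsup, htotal]
  have hproj : (⨆ m, initialSpan v m).topologicalClosure.starProjection hY.toLp
      = (condExpL2 ℝ ℝ hle hY.toLp : Lp ℝ 2 μ) := by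
    refine Submodule.eq_starProjection_of_mem_of_inner_eq_zero ?_ fun w hw => ?_
    · rw [hcl]; exact Subtype.mem _
    · rw [hcl] at hw
      have : Fact (MeasurableSpace.comap (X k) inferInstance
        ≤ (inferInstance : MeasurableSpace Ω)) := ⟨hle⟩
      exact Submodule.starProjection_inner_eq_zero
        (K := lpMeas ℝ ℝ (MeasurableSpace.comap (X k) inferInstance) 2 μ) _ w hw
  have hlim := Submodule.starProjection_tendsto_closure_iSup (initialSpan v) hUmono hY.toLp
  rw [hproj] at hlim
  have hce : (condExpL2 ℝ ℝ hle hY.toLp : Lp ℝ 2 μ)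
      = (hY.condExp (m := MeasurableSpace.comap (X k) inferInstance) one_le_two).toLp := by
    apply Lp.ext
    exact (hY.condExpL2_ae_eq_condExp hle).trans (MemLp.coeFn_toLp _).symm
  have h0 : Tendsto (fun m => ENNReal.ofReal (‖(initialSpan v m).starProjection hY.toLp
      - (condExpL2 ℝ ℝ hle hY.toLp : Lp ℝ 2 μ)‖ ^ 2)) atTop (𝓝 0) := by
    have := ENNReal.tendsto_ofReal ((tendsto_iff_norm_sub_tendsto_zero.1 hlim).pow 2)
    simpa using this
  refine h0.congr fun m => ?_
  have hreg := toLp_regression (m := m) he hind hY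
  rw [← hv] at hreg
  rw [← hreg, hce, ← MemLp.toLp_sub]
  exact (secondMoment_eq_ofReal_norm _).symm

end Regression

end SwingContract

/-! ### The value function -/

/-- A family of measurable functions that is bounded and Lipschitz in the parameter `R ∈ s`, both
with the measurable function `ℓ` as constant. -/
structure LipschitzFamily {E : Type*} [MeasurableSpace E] (s : Set ℝ) (F : ℝ → E → ℝ)
    (ℓ : E → ℝ) : Prop where
  measurable : ∀ R ∈ s, Measurable (F R)
  measurable_bound : Measurable ℓ
  nonneg : ∀ x, 0 ≤ ℓ x
  abs_le : ∀ R ∈ s, ∀ x, |F R x| ≤ ℓ x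
  lipschitz : ∀ R ∈ s, ∀ R' ∈ s, ∀ x, |F R' x - F R x| ≤ ℓ x * |R' - R|

section LipschitzFamily

variable {E : Type*} [MeasurableSpace E] {s : Set ℝ} {F : ℝ → E → ℝ} {ℓ : E → ℝ}

lemma LipschitzFamily.continuousOn (hF : LipschitzFamily s F ℓ) (x : E) :
    ContinuousOn (fun R => F R x) s := by
  refine (LipschitzOnWith.of_dist_le_mul (K := (ℓ x).toNNReal) fun R hR R' hR' => ?_).continuousOn
  rw [Real.dist_eq, Real.dist_eq, Real.coe_toNNReal _ (hF.nonneg x)]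
  exact hF.lipschitz R' hR' R hR x

lemma LipschitzFamily.memLp_comp {Ω : Type*} [MeasurableSpace Ω] {μ : Measure Ω} {Y : Ω → E}
    (hY : Measurable Y) (hF : LipschitzFamily s F ℓ) (hℓ : MemLp (fun ω => ℓ (Y ω)) 2 μ) {R : ℝ}
    (hR : R ∈ s) : MemLp (fun ω => F R (Y ω)) 2 μ :=
  hℓ.mono' ((hF.measurable R hR).comp hY).aestronglyMeasurable
    (Eventually.of_forall fun ω => hF.abs_le R hR (Y ω))

/-- Integration against a kernel preserves Lipschitz families. The integrals are replaced by `0` at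
the points where the Lipschitz constant is not integrable, its integral being `0` there. -/
lemma LipschitzFamily.integral_kernel (hF : LipschitzFamily s F ℓ) (κ : Kernel E E) :
    LipschitzFamily s (fun R => {x | Integrable ℓ (κ x)}.indicator fun x => ∫ y, F R y ∂κ x)
      (fun x => ∫ y, ℓ y ∂κ x) := by
  have hint : ∀ x, Integrable ℓ (κ x) → ∀ R ∈ s, Integrable (F R) (κ x) := fun x hx R hR =>
    hx.mono' (hF.measurable R hR).aestronglyMeasurable
      (Eventually.of_forall fun y => hF.abs_le R hR y)
  have hnn : ∀ x, 0 ≤ ∫ y, ℓ y ∂κ x := fun x => integral_nonneg hF.nonneg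
  refine ⟨fun R hR => ?_, ?_, hnn, fun R hR x => ?_, fun R hR R' hR' x => ?_⟩
  · exact ((hF.measurable R hR).stronglyMeasurable.integral_kernel (κ := κ)).measurable.indicator
      (measurableSet_integrable hF.measurable_bound.stronglyMeasurable)
  · exact (hF.measurable_bound.stronglyMeasurable.integral_kernel (κ := κ)).measurable
  · by_cases hx : Integrable ℓ (κ x)
    · rw [Set.indicator_of_mem (by exact hx)]
      exact norm_integral_le_of_norm_le (f := F R) hx
        (Eventually.of_forall fun y => hF.abs_le R hR y)
    · rw [Set.indicator_of_notMem (by exact hx), abs_zero]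
      exact hnn x
  · by_cases hx : Integrable ℓ (κ x)
    · rw [Set.indicator_of_mem (by exact hx), Set.indicator_of_mem (by exact hx),
        ← integral_sub (hint x hx R' hR') (hint x hx R hR), ← integral_mul_const]
      exact norm_integral_le_of_norm_le (f := fun y => F R' y - F R y) (hx.mul_const _)
        (Eventually.of_forall fun y => hF.lipschitz R hR R' hR' y)
    · rw [Set.indicator_of_notMem (by exact hx), Set.indicator_of_notMem (by exact hx), sub_zero,
        abs_zero]
      exact mul_nonneg (hnn x) (abs_nonneg _)

end LipschitzFamily

namespace SwingContract

section Value

variable {c : SwingContract} {E : Type*} [MeasurableSpace E] {k : ℕ}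

lemma lipschitzFamily_stepValue (hne : ∀ Q ∈ c.consumption k, (c.volumes k Q).Nonempty)
    {G : E → ℝ} (hG : Measurable G) {F : ℝ → E → ℝ} {ℓ : E → ℝ}
    (hF : LipschitzFamily (c.consumption (k + 1)) F ℓ) :
    LipschitzFamily (c.consumption k) (fun Q x => c.stepValue k (G x) (fun R => F R x) Q)
      (fun x => (1 + |c.qmin| + |c.qmax|) * |G x| + 3 * ℓ x) := by
  refine ⟨fun Q hQ => measurable_stepValue hG hF.measurable hF.continuousOn (hne Q hQ),
    (measurable_norm.comp hG |>.const_mul _).add (hF.measurable_bound.const_mul _),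
    fun x => ?_, fun Q hQ x => ?_, fun Q hQ Q' hQ' x => ?_⟩
  · have := hF.nonneg x
    positivity
  · have h := abs_stepValue_le (hF.continuousOn x) (G x) (hne Q hQ) fun R hR => hF.abs_le R hR x
    have := hF.nonneg x
    have := abs_nonneg (G x)
    linarith
  · refine (abs_stepValue_increment_le_of_lipschitz (hF.nonneg x) (hF.continuousOn x)
      (fun R hR R' hR' => hF.lipschitz R hR R' hR' x) (G x) (hne Q hQ) (hne Q' hQ')).trans ?_
    have h1 := abs_nonneg (G x)
    have h2 : 0 ≤ (|c.qmin| + |c.qmax|) * |G x| := by positivity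
    gcongr
    linarith

lemma memLp_stepValue_bound {Ω : Type*} [MeasurableSpace Ω] {μ : Measure Ω} {G ℓ : Ω → ℝ}
    (hG : MemLp G 2 μ) (hℓ : MemLp ℓ 2 μ) :
    MemLp (fun ω => (1 + |c.qmin| + |c.qmax|) * |G ω| + 3 * ℓ ω) 2 μ :=
  (hG.abs.const_mul _).add (hℓ.const_mul _)

variable [StandardBorelSpace E] [Nonempty E] {Ω : Type*} [MeasurableSpace Ω] {μ : Measure Ω}
  [IsFiniteMeasure μ] {X : ℕ → Ω → E} {g : ℕ → E → ℝ}

/-- `F` is a regular version, with a square integrable Lipschitz constant, of the continuation value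
of the swing contract at `t_k`, i.e. of the conditional expectations of the value at `t_{k+1}`. At
the last exercise date the continuation value is zero. -/
structure IsContinuation (c : SwingContract) (μ : Measure Ω) [IsFiniteMeasure μ] (X : ℕ → Ω → E)
    (g : ℕ → E → ℝ) (k : ℕ) (F : ℝ → E → ℝ) (ℓ : E → ℝ) : Prop where
  lipschitz : LipschitzFamily (c.consumption (k + 1)) F ℓ
  memLp_bound : MemLp (fun ω => ℓ (X k ω)) 2 μ
  value_eq : ∀ᵐ x ∂μ.map (X k), ∀ Q ∈ c.consumption k,
    c.value μ X g k x Q = c.stepValue k (g k x - c.strike) (fun R => F R x) Q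
  condExp : k + 1 < c.n → ∀ R ∈ c.consumption (k + 1), (fun ω => F R (X k ω)) =ᵐ[μ]
    μ[fun ω => c.value μ X g (k + 1) (X (k + 1) ω) R | MeasurableSpace.comap (X k) inferInstance]
  eq_zero : k + 1 = c.n → F = 0

/-- Backward induction along the exercise dates. -/
lemma backward_induction {n : ℕ} {P : ℕ → Prop} (hlast : ∀ k, k + 1 = n → P k)
    (hstep : ∀ k, k + 1 < n → P (k + 1) → P k) : ∀ k < n, P k := by
  have h : ∀ j k, k + j + 1 = n → P k := by
    intro j
    induction j with
    | zero => exact hlast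
    | succ j ih => exact fun k hk => hstep k (by omega) (ih (k + 1) (by omega))
  exact fun k hk => h (n - k - 1) k (by omega)

lemma IsContinuation.value_comp_ae_eq (hX : Measurable (X k)) {F : ℝ → E → ℝ} {ℓ : E → ℝ}
    (h : IsContinuation c μ X g k F ℓ) {Q : ℝ} (hQ : Q ∈ c.consumption k) :
    (fun ω => c.value μ X g k (X k ω) Q) =ᵐ[μ]
      fun ω => c.stepValue k (g k (X k ω) - c.strike) (fun R => F R (X k ω)) Q :=
  (ae_of_ae_map hX.aemeasurable h.value_eq).mono fun _ hω => hω Q hQ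

lemma IsContinuation.memLp_value (hX : Measurable (X k))
    (hne : ∀ Q ∈ c.consumption k, (c.volumes k Q).Nonempty) (hg : Measurable (g k))
    (hgX : MemLp (fun ω => g k (X k ω) - c.strike) 2 μ) {F : ℝ → E → ℝ} {ℓ : E → ℝ}
    (h : IsContinuation c μ X g k F ℓ) {Q : ℝ} (hQ : Q ∈ c.consumption k) :
    MemLp (fun ω => c.value μ X g k (X k ω) Q) 2 μ := by
  have hW := lipschitzFamily_stepValue hne (hg.sub_const c.strike) h.lipschitz
  exact (memLp_congr_ae (h.value_comp_ae_eq hX hQ)).2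
    (hW.memLp_comp hX (memLp_stepValue_bound hgX h.memLp_bound) hQ)

lemma isContinuation_last (hk : k + 1 = c.n) :
    IsContinuation c μ X g k (fun _ _ => 0) (fun _ => 0) := by
  refine ⟨⟨fun _ _ => measurable_const, measurable_const, fun _ => le_rfl, by simp, by simp⟩,
    MemLp.zero, Eventually.of_forall fun x Q _ => ?_, fun h => absurd h (by omega), fun _ => rfl⟩
  rw [value, if_neg (by omega), stepValue]
  simp [payoff]

lemma IsContinuation.exists_prev (hk : k + 1 < c.n) (hX : Measurable (X k))
    (hX' : Measurable (X (k + 1)))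
    (hne : ∀ Q ∈ c.consumption (k + 1), (c.volumes (k + 1) Q).Nonempty)
    (hg : Measurable (g (k + 1)))
    (hgX : MemLp (fun ω => g (k + 1) (X (k + 1) ω) - c.strike) 2 μ) {F : ℝ → E → ℝ} {ℓ : E → ℝ}
    (h : IsContinuation c μ X g (k + 1) F ℓ) :
    ∃ F' ℓ', IsContinuation c μ X g k F' ℓ' := by
  have hW := lipschitzFamily_stepValue hne (hg.sub_const c.strike) h.lipschitz
  set W : ℝ → E → ℝ := fun Q x =>
    c.stepValue (k + 1) (g (k + 1) x - c.strike) (fun R => F R x) Q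
  set b : E → ℝ := fun x => (1 + |c.qmin| + |c.qmax|) * |g (k + 1) x - c.strike| + 3 * ℓ x
  have hb : MemLp (fun ω => b (X (k + 1) ω)) 2 μ :=
    memLp_stepValue_bound hgX h.memLp_bound
  set κ := condDistrib (X (k + 1)) (X k) μ
  have hbint : Integrable (fun ω => b (X (k + 1) ω)) μ := hb.integrable one_le_two
  have hbae : ∀ᵐ x ∂μ.map (X k), Integrable b (κ x) := by
    refine Integrable.condDistrib_ae_map (f := fun p : E × E => b p.2) hX'.aemeasurable ?_
    exact (integrable_map_measure
      (hW.measurable_bound.comp measurable_snd).aestronglyMeasurable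
      (hX.aemeasurable.prodMk hX'.aemeasurable)).2 hbint
  have hvae : ∀ᵐ x ∂μ.map (X k), ∀ᵐ y ∂κ x, ∀ Q ∈ c.consumption (k + 1),
      c.value μ X g (k + 1) y Q = W Q y := by
    have hv := h.value_eq
    rw [← condDistrib_comp_map hX.aemeasurable hX'.aemeasurable] at hv
    exact Measure.ae_ae_of_ae_comp hv
  refine ⟨_, _, ⟨hW.integral_kernel κ, ?_, ?_, fun _ R hR => ?_, fun h => absurd h hk.ne⟩⟩
  · refine (memLp_congr_ae ?_).1 (hb.condExp (m := MeasurableSpace.comap (X k) inferInstance)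
      one_le_two)
    exact condExp_ae_eq_integral_condDistrib hX hX'.aemeasurable
      hW.measurable_bound.stronglyMeasurable hbint
  · filter_upwards [hbae, hvae] with x hx1 hx2 Q hQ
    rw [value, if_pos hk, stepValue]
    congr 1
    refine Set.image_congr fun q hq => ?_
    rw [Set.indicator_of_mem (by exact hx1)]
    rw [payoff]
    congr 1
    exact integral_congr_ae (hx2.mono fun y hy => hy _ (add_mem_consumption hq))
  · have h1 := condExp_ae_eq_integral_condDistrib hX hX'.aemeasurable
      (hW.measurable R hR).stronglyMeasurable
      ((hW.memLp_comp hX' hb hR).integrable one_le_two)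
    have h2 := condExp_congr_ae (m := MeasurableSpace.comap (X k) inferInstance)
      (h.value_comp_ae_eq hX' hR)
    filter_upwards [h1, h2, ae_of_ae_map hX.aemeasurable hbae] with ω hω1 hω2 hω3
    rw [hω2, Set.indicator_of_mem (by exact hω3)]
    exact hω1.symm

/-- By backward induction, the swing value function has regular continuation values at all
exercise dates. -/
lemma exists_isContinuation (hadm : ∀ k < c.n, ∀ Q ∈ c.consumption k, (c.volumes k Q).Nonempty)
    (hX : ∀ k < c.n, Measurable (X k)) (hg : ∀ k < c.n, Measurable (g k))
    (hgX : ∀ k < c.n, MemLp (fun ω => g k (X k ω) - c.strike) 2 μ) :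
    ∀ k < c.n, ∃ F ℓ, IsContinuation c μ X g k F ℓ :=
  backward_induction (fun _ hk => ⟨_, _, isContinuation_last hk⟩) fun k hk ⟨_, _, h⟩ =>
    h.exists_prev hk (hX k (by omega)) (hX _ hk) (hadm _ hk) (hg _ hk) (hgX _ hk)

end Value

end SwingContract

/-! ### The least-squares approximation -/

lemma L2Control.congr_ae {Ω : Type*} [MeasurableSpace Ω] {μ : Measure Ω} {Z Z' : ℝ → Ω → ℝ}
    {s : Set ℝ} {v : ℝ → ℝ} (hZ : L2Control μ Z s v) (h : ∀ t ∈ s, Z' t =ᵐ[μ] Z t) :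
    L2Control μ Z' s v := by
  refine ⟨hZ.mono, fun r hr t ht hrt => le_trans (le_of_eq ?_) (hZ.incr r hr t ht hrt)⟩
  refine secondMoment_congr_ae ?_
  filter_upwards [h r hr, h t ht] with ω h1 h2
  rw [h1, h2]

lemma memLp_two_of_secondMoment_lt_top {Ω : Type*} [MeasurableSpace Ω] {μ : Measure Ω} {f : Ω → ℝ}
    (hf : AEStronglyMeasurable f μ) (h : secondMoment μ f < ∞) : MemLp f 2 μ := by
  refine ⟨hf, ?_⟩
  rw [← eLpNorm_two_sq] at h
  exact (ENNReal.pow_lt_top_iff.1 h).resolve_right two_ne_zero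

namespace SwingContract

section LeastSquares

variable {c : SwingContract} {Ω : Type*} [MeasurableSpace Ω] {μ : Measure Ω} {k : ℕ}

/-- A family of square integrable variables with continuous paths over the consumptions at `t_k`
and with controlled increments of total size at most `L`. -/
structure RegularFamily (c : SwingContract) (μ : Measure Ω) (k : ℕ) (L : ℝ) (Z : ℝ → Ω → ℝ) :
    Prop where
  measurable : ∀ R ∈ c.consumption k, Measurable (Z R)
  memLp : ∀ R ∈ c.consumption k, MemLp (Z R) 2 μ
  continuousOn : ∀ ω, ContinuousOn (fun R => Z R ω) (c.consumption k)
  control : ∃ v, L2Control μ Z (c.consumption k) v ∧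
    ∀ r ∈ c.consumption k, ∀ t ∈ c.consumption k, v t - v r ≤ L

/-- The optimal values for two continuation values differ at most by the supremum of the difference
of the latter over all consumptions. -/
lemma secondMoment_stepValue_sub_le {G : Ω → ℝ} {F F' : ℝ → Ω → ℝ}
    (hF : ∀ ω, ContinuousOn (fun R => F R ω) (c.consumption (k + 1)))
    (hF' : ∀ ω, ContinuousOn (fun R => F' R ω) (c.consumption (k + 1))) {Q : ℝ}
    (hne : (c.volumes k Q).Nonempty) :
    secondMoment μ (fun ω => c.stepValue k (G ω) (fun R => F R ω) Q
        - c.stepValue k (G ω) (fun R => F' R ω) Q)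
      ≤ ∫⁻ ω, ⨆ R ∈ c.consumption (k + 1), ENNReal.ofReal ((F R ω - F' R ω) ^ 2) ∂μ := by
  refine lintegral_mono fun ω => ?_
  set S := ⨆ R ∈ c.consumption (k + 1), ENNReal.ofReal ((F R ω - F' R ω) ^ 2) with hS
  by_cases htop : S = ∞
  · simp [htop]
  have h := abs_stepValue_sub_le (hF ω) (hF' ω) (G ω) hne (δ := √S.toReal) fun R hR =>
    Real.abs_le_sqrt ((ENNReal.ofReal_le_iff_le_toReal htop).1
      (le_iSup₂ (f := fun R (_ : R ∈ c.consumption (k + 1)) =>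
        ENNReal.ofReal ((F R ω - F' R ω) ^ 2)) R hR))
  refine (ENNReal.ofReal_le_iff_le_toReal htop).2 ?_
  rw [← sq_abs, ← Real.sq_sqrt (ENNReal.toReal_nonneg (a := S))]
  gcongr

lemma memLp_stepValue {G : Ω → ℝ} (hG : Measurable G) (hG2 : MemLp G 2 μ) {F : ℝ → Ω → ℝ} {L : ℝ}
    (hF : RegularFamily c μ (k + 1) L F) {Q : ℝ} (hne : (c.volumes k Q).Nonempty) :
    MemLp (fun ω => c.stepValue k (G ω) (fun R => F R ω) Q) 2 μ := by
  have hc0 : ∀ ω : Ω, ContinuousOn (fun _ : ℝ => (0 : ℝ)) (c.consumption (k + 1)) :=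
    fun _ => continuousOn_const
  -- Comparison with the continuation value zero, for which the bound is immediate.
  have h0m := measurable_stepValue hG (F := fun _ _ => 0) (fun _ _ => measurable_const) hc0 hne
  have h0 : MemLp (fun ω => c.stepValue k (G ω) (fun _ => 0) Q) 2 μ := by
    refine (hG2.abs.mul_const (|c.qmin| + |c.qmax|)).mono' h0m.aestronglyMeasurable
      (Eventually.of_forall fun ω => ?_)
    simpa using abs_stepValue_le (hc0 ω) (G ω) hne (B := 0) (by simp)
  have hd : MemLp (fun ω => c.stepValue k (G ω) (fun R => F R ω) Q
      - c.stepValue k (G ω) (fun _ => 0) Q) 2 μ := by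
    refine memLp_two_of_secondMoment_lt_top
      ((measurable_stepValue hG hF.measurable hF.continuousOn hne).sub h0m).aestronglyMeasurable
      ((secondMoment_stepValue_sub_le hF.continuousOn hc0 hne).trans_lt ?_)
    obtain ⟨v, hv, -⟩ := hF.control
    have hab : c.Qdown (k + 1) ≤ c.Qup (k + 1) := (lowEnd_mem hne).1.trans (lowEnd_mem hne).2
    have hmax := hv.lintegral_iSup_le hab (fun R hR => (hF.measurable R hR).aemeasurable)
      hF.continuousOn 0
    simp only [sub_zero]
    refine hmax.trans_lt (ENNReal.add_lt_top.2 ⟨?_, ENNReal.ofReal_lt_top⟩)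
    simp only [zero_add, Finset.sum_range_one, CharP.cast_eq_zero, zero_div, mul_zero, add_zero]
    exact ENNReal.mul_lt_top (by simp) (secondMoment_lt_top (hF.memLp _ ⟨le_rfl, hab⟩))
  exact (memLp_congr_ae (Eventually.of_forall fun ω => by simp)).1 (hd.add h0)

variable {E : Type*} [MeasurableSpace E] {X : ℕ → Ω → E} {g : ℕ → E → ℝ} {e : ℕ → E → ℝ}

/-- The continuation value at `t_k` that enters the least-squares approximation: the regression of
the approximation at `t_{k+1}`, or zero at the last exercise date. -/
def lsContinuation (c : SwingContract) (μ : Measure Ω) (X : ℕ → Ω → E) (g : ℕ → E → ℝ)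
    (e : ℕ → E → ℝ) (m k : ℕ) (R : ℝ) : Ω → ℝ :=
  if k + 1 < c.n then regression μ X e m k (c.lsValue μ X g e m (k + 1) R) else 0

lemma lsValue_eq (m k : ℕ) (Q : ℝ) :
    c.lsValue μ X g e m k Q = essSupFamily μ ((fun (q : Ω → ℝ) (ω : Ω) =>
      q ω * (g k (X k ω) - c.strike) + c.lsContinuation μ X g e m k (Q + q ω) ω)
        '' c.adm μ X k Q) := by
  rw [lsValue]
  split_ifs with h
  · simp only [lsContinuation, if_pos h, payoff, regression]
  · simp only [lsContinuation, if_neg h, payoff, Pi.zero_apply, add_zero]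

lemma lsValue_ae_eq (hX : Measurable (X k)) (hg : Measurable (g k)) {m : ℕ} {L : ℝ}
    (h : RegularFamily c μ (k + 1) L (c.lsContinuation μ X g e m k)) {Q : ℝ}
    (hne : (c.volumes k Q).Nonempty) :
    c.lsValue μ X g e m k Q =ᵐ[μ] fun ω => c.stepValue k (g k (X k ω) - c.strike)
      (fun R => c.lsContinuation μ X g e m k R ω) Q := by
  rw [lsValue_eq]
  exact essSupFamily_ae_eq (isEssSup_stepValue μ X ((hg.comp hX).sub_const _) h.measurable
    h.continuousOn hne)

lemma regularFamily_lsContinuation_last (hk : k + 1 = c.n) (m : ℕ) :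
    RegularFamily c μ (k + 1) 0 (c.lsContinuation μ X g e m k) := by
  have h : c.lsContinuation μ X g e m k = fun _ => 0 := by
    funext R
    rw [lsContinuation, if_neg (by omega)]
  rw [h]
  refine ⟨fun _ _ => measurable_zero, fun _ _ => MemLp.zero, fun ω => continuousOn_const,
    fun _ => 0, ⟨fun _ _ _ _ _ => le_rfl, fun _ _ _ _ _ => ?_⟩, by simp⟩
  simp [secondMoment]

/-- The backward step for the regularity of the approximation: the one-step optimization multiplies
the control by a constant that does not depend on the number `m` of regression functions, and the
regression, being an orthogonal projection, does not increase it. -/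
lemma RegularFamily.lsContinuation_prev (hk : k + 1 < c.n) (hX : Measurable (X k))
    (hX' : Measurable (X (k + 1)))
    (hne : ∀ Q ∈ c.consumption (k + 1), (c.volumes (k + 1) Q).Nonempty)
    (hg : Measurable (g (k + 1)))
    (hgX : MemLp (fun ω => g (k + 1) (X (k + 1) ω) - c.strike) 2 μ) (hem : ∀ i, Measurable (e i))
    (he : ∀ i, MemLp (fun ω => e i (X k ω)) 2 μ)
    (hind : LinearIndependent ℝ fun i : ℕ => (he i).toLp) {m : ℕ} {L : ℝ}
    (h : RegularFamily c μ (k + 1 + 1) L (c.lsContinuation μ X g e m (k + 1))) :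
    (∀ Q ∈ c.consumption (k + 1), MemLp (c.lsValue μ X g e m (k + 1) Q) 2 μ) ∧
    RegularFamily c μ (k + 1)
      (3 * (secondMoment μ (fun ω => g (k + 1) (X (k + 1) ω) - c.strike)).toReal
        * |c.Qup (k + 1) - c.Qdown (k + 1)| + 15 * L) (c.lsContinuation μ X g e m k) := by
  have hGm : Measurable fun ω => g (k + 1) (X (k + 1) ω) - c.strike :=
    (hg.comp hX').sub_const _
  have hae := fun Q hQ => lsValue_ae_eq hX' hg h (hne Q hQ)
  have hmem : ∀ Q ∈ c.consumption (k + 1), MemLp (c.lsValue μ X g e m (k + 1) Q) 2 μ :=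
    fun Q hQ => (memLp_congr_ae (hae Q hQ)).2 (memLp_stepValue hGm hgX h (hne Q hQ))
  obtain ⟨v, hv, hvL⟩ := h.control
  have hcontrol := (L2Control_stepValue hgX h.measurable h.continuousOn hne hv).congr_ae hae
  have heq : c.lsContinuation μ X g e m k
      = fun R => regression μ X e m k (c.lsValue μ X g e m (k + 1) R) := by
    funext R
    rw [lsContinuation, if_pos hk]
  refine ⟨hmem, ?_⟩
  rw [heq]
  refine ⟨fun R _ => ?_, fun R _ => memLp_regression he _,
    fun ω => continuousOn_regression he hcontrol hmem ω,
    _, L2Control_regression he hind hcontrol hmem, fun r hr t ht => ?_⟩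
  · exact Finset.measurable_fun_sum _ fun i _ => ((hem i).comp hX).const_mul _
  · have h1 := hvL _ (lowEnd_mem (hne r hr)) _ (lowEnd_mem (hne t ht))
    have h2 := hvL _ (highEnd_mem (hne r hr)) _ (highEnd_mem (hne t ht))
    have h3 : t - r ≤ |c.Qup (k + 1) - c.Qdown (k + 1)| :=
      (sub_le_sub ht.2 hr.1).trans (le_abs_self _)
    have h4 := mul_le_mul_of_nonneg_left h3 (mul_nonneg (zero_le_three (α := ℝ))
      (ENNReal.toReal_nonneg (a := secondMoment μ fun ω => g (k + 1) (X (k + 1) ω) - c.strike)))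
    linarith

/-- The continuation values in the least-squares approximation are regular, with a bound on the
control that is uniform in the number `m` of regression functions. -/
lemma exists_regularFamily_lsContinuation
    (hadm : ∀ k < c.n, ∀ Q ∈ c.consumption k, (c.volumes k Q).Nonempty)
    (hX : ∀ k < c.n, Measurable (X k)) (hg : ∀ k < c.n, Measurable (g k))
    (hgX : ∀ k < c.n, MemLp (fun ω => g k (X k ω) - c.strike) 2 μ) (hem : ∀ i, Measurable (e i))
    (he : ∀ k < c.n, ∀ i, MemLp (fun ω => e i (X k ω)) 2 μ)
    (hind : ∀ k, ∀ hk : k < c.n, LinearIndependent ℝ fun i : ℕ => (he k hk i).toLp) :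
    ∀ k < c.n, ∃ L, ∀ m, RegularFamily c μ (k + 1) L (c.lsContinuation μ X g e m k) :=
  backward_induction (fun _ hk => ⟨0, regularFamily_lsContinuation_last hk⟩) fun k hk ⟨_, h⟩ =>
    ⟨_, fun m => ((h m).lsContinuation_prev hk (hX k (by omega)) (hX _ hk) (hadm _ hk) (hg _ hk)
      (hgX _ hk) hem (he k (by omega)) (hind k (by omega))).2⟩

/-! ### Convergence -/

/-- The error of the approximation at `t_k` is at most the error of the continuation values at
`t_k`, uniformly in the consumption. -/
lemma secondMoment_lsValue_sub_value_le [StandardBorelSpace E] [Nonempty E] [IsFiniteMeasure μ]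
    (hX : Measurable (X k)) (hg : Measurable (g k)) {m : ℕ} {L : ℝ} {F : ℝ → E → ℝ} {ℓ : E → ℝ}
    (hF : IsContinuation c μ X g k F ℓ)
    (h : RegularFamily c μ (k + 1) L (c.lsContinuation μ X g e m k)) {Q : ℝ}
    (hQ : Q ∈ c.consumption k) (hne : (c.volumes k Q).Nonempty) :
    secondMoment μ (fun ω => c.lsValue μ X g e m k Q ω - c.value μ X g k (X k ω) Q)
      ≤ ∫⁻ ω, ⨆ R ∈ c.consumption (k + 1),
        ENNReal.ofReal ((c.lsContinuation μ X g e m k R ω - F R (X k ω)) ^ 2) ∂μ := by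
  have hae : (fun ω => c.lsValue μ X g e m k Q ω - c.value μ X g k (X k ω) Q) =ᵐ[μ]
      fun ω => c.stepValue k (g k (X k ω) - c.strike)
          (fun R => c.lsContinuation μ X g e m k R ω) Q
        - c.stepValue k (g k (X k ω) - c.strike) (fun R => F R (X k ω)) Q := by
    filter_upwards [lsValue_ae_eq hX hg h hne, hF.value_comp_ae_eq hX hQ] with ω h1 h2
    rw [h1, h2]
  rw [secondMoment_congr_ae hae]
  exact secondMoment_stepValue_sub_le (F' := fun R ω => F R (X k ω)) h.continuousOn
    (fun ω => hF.lipschitz.continuousOn (X k ω)) hne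

/-- The uniform convergence of the approximation in `L²`, in terms of second moments. In the
backward step the error of the continuation values is the sum of the regression of the error at
`t_{k+1}` and of the error of the regression of the true value. It vanishes in the limit for every
single consumption, hence, its increments being controlled uniformly in `m`, also for the supremum
over all consumptions. -/
lemma tendsto_iSup_secondMoment [StandardBorelSpace E] [Nonempty E] [IsFiniteMeasure μ]
    (hadm : ∀ k < c.n, ∀ Q ∈ c.consumption k, (c.volumes k Q).Nonempty)
    (hX : ∀ k < c.n, Measurable (X k)) (hg : ∀ k < c.n, Measurable (g k))
    (hgX : ∀ k < c.n, MemLp (fun ω => g k (X k ω) - c.strike) 2 μ) (hem : ∀ i, Measurable (e i))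
    (he : ∀ k < c.n, ∀ i, MemLp (fun ω => e i (X k ω)) 2 μ)
    (htotal : ∀ k, ∀ hk : k < c.n,
      (Submodule.span ℝ (Set.range fun i : ℕ => (he k hk i).toLp)).topologicalClosure
        = lpMeas ℝ ℝ (MeasurableSpace.comap (X k) inferInstance) 2 μ)
    (hind : ∀ k, ∀ hk : k < c.n, LinearIndependent ℝ fun i : ℕ => (he k hk i).toLp) :
    ∀ k < c.n, Tendsto (fun m => ⨆ Q ∈ c.consumption k, secondMoment μ
      (fun ω => c.lsValue μ X g e m k Q ω - c.value μ X g k (X k ω) Q)) atTop (𝓝 0) := by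
  have hcont := exists_isContinuation hadm hX hg hgX
  have hreg := exists_regularFamily_lsContinuation hadm hX hg hgX hem he hind
  refine backward_induction (fun k hk => ?_) (fun k hk ih => ?_)
  · have hkn : k < c.n := by omega
    obtain ⟨F, ℓ, hF⟩ := hcont k hkn
    obtain ⟨L, hL⟩ := hreg k hkn
    refine tendsto_const_nhds.congr fun m => ?_
    symm
    rw [← nonpos_iff_eq_zero]
    refine iSup₂_le fun Q hQ => (secondMoment_lsValue_sub_value_le (hX k hkn) (hg k hkn) hF (hL m)
      hQ (hadm k hkn Q hQ)).trans (le_of_eq ?_)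
    simp [hF.eq_zero hk, lsContinuation, hk]
  have hkn : k < c.n := by omega
  obtain ⟨F, ℓ, hF⟩ := hcont k hkn
  obtain ⟨F', ℓ', hF'⟩ := hcont (k + 1) hk
  obtain ⟨L, hL⟩ := hreg k hkn
  obtain ⟨L', hL'⟩ := hreg (k + 1) hk
  rcases (c.consumption k).eq_empty_or_nonempty with hemp | ⟨Q₀, hQ₀⟩
  · simp [hemp]
  have hab : c.Qdown (k + 1) ≤ c.Qup (k + 1) :=
    (lowEnd_mem (hadm k hkn Q₀ hQ₀)).1.trans (lowEnd_mem (hadm k hkn Q₀ hQ₀)).2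
  have hls : ∀ m, ∀ R ∈ c.consumption (k + 1), MemLp (c.lsValue μ X g e m (k + 1) R) 2 μ :=
    fun m => ((hL' m).lsContinuation_prev hk (hX k hkn) (hX _ hk) (hadm _ hk) (hg _ hk)
      (hgX _ hk) hem (he k hkn) (hind k hkn)).1
  have hval : ∀ R ∈ c.consumption (k + 1),
      MemLp (fun ω => c.value μ X g (k + 1) (X (k + 1) ω) R) 2 μ := fun R hR =>
    hF'.memLp_value (hX _ hk) (hadm _ hk) (hg _ hk) (hgX _ hk) hR
  choose v hv hvL using fun m => (hL m).control
  have hFm : ∀ R ∈ c.consumption (k + 1), Measurable fun ω => F R (X k ω) := fun R hR =>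
    (hF.lipschitz.measurable R hR).comp (hX k hkn)
  have hw : L2Control μ (fun R ω => F R (X k ω)) (c.consumption (k + 1))
      (fun t => (secondMoment μ fun ω => ℓ (X k ω)).toReal * t) :=
    .of_lipschitz hF.memLp_bound fun r hr t ht =>
      Eventually.of_forall fun ω => hF.lipschitz.lipschitz r hr t ht (X k ω)
  have hpoint : ∀ R ∈ c.consumption (k + 1), Tendsto (fun m => secondMoment μ fun ω =>
      c.lsContinuation μ X g e m k R ω - F R (X k ω)) atTop (𝓝 0) := by
    intro R hR
    have h1 : Tendsto (fun m => secondMoment μ fun ω => c.lsValue μ X g e m (k + 1) R ω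
        - c.value μ X g (k + 1) (X (k + 1) ω) R) atTop (𝓝 0) :=
      tendsto_of_tendsto_of_tendsto_of_le_of_le tendsto_const_nhds ih (fun _ => zero_le)
        fun m => le_iSup₂ (f := fun Q (_ : Q ∈ c.consumption (k + 1)) => secondMoment μ fun ω =>
          c.lsValue μ X g e m (k + 1) Q ω - c.value μ X g (k + 1) (X (k + 1) ω) Q) R hR
    have h2 := tendsto_secondMoment_regression_sub_condExp (hX k hkn) (he k hkn) (hind k hkn)
      (htotal k hkn) (hval R hR)
    have h12 := (ENNReal.Tendsto.const_mul (a := 2) h1 (by simp)).add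
      (ENNReal.Tendsto.const_mul (a := 2) h2 (by simp))
    rw [mul_zero, add_zero] at h12
    refine tendsto_of_tendsto_of_tendsto_of_le_of_le tendsto_const_nhds h12 (fun _ => zero_le)
      fun m => ?_
    set V := fun ω => c.value μ X g (k + 1) (X (k + 1) ω) R
    -- `F R` is the conditional expectation of the true value `V`, and the regression is linear.
    have hsplit : (fun ω => c.lsContinuation μ X g e m k R ω - F R (X k ω)) =ᵐ[μ] fun ω =>
        regression μ X e m k (fun ω => c.lsValue μ X g e m (k + 1) R ω - V ω) ω
          + (regression μ X e m k V ω
            - (μ[V | MeasurableSpace.comap (X k) inferInstance]) ω) := by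
      filter_upwards [hF.condExp hk R hR] with ω hω
      rw [regression_sub (he k hkn) (hls m R hR) (hval R hR), ← hω, lsContinuation, if_pos hk]
      ring
    rw [secondMoment_congr_ae hsplit]
    refine (secondMoment_add_le
      (memLp_regression (he k hkn) _).aestronglyMeasurable.aemeasurable).trans ?_
    gcongr
    exact secondMoment_regression_le (he k hkn) (hind k hkn) ((hls m R hR).sub (hval R hR))
  have hJ := tendsto_lintegral_iSup_zero hab
    (fun m => (hv m).sub hw fun R hR => ((hL m).measurable R hR).aemeasurable)
    (L := 2 * L + 2 * ((secondMoment μ fun ω => ℓ (X k ω)).toReal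
      * (c.Qup (k + 1) - c.Qdown (k + 1))))
    (fun m => by
      have := hvL m _ (Set.left_mem_Icc.2 hab) _ (Set.right_mem_Icc.2 hab)
      linarith)
    (fun m R hR => (((hL m).measurable R hR).sub (hFm R hR)).aemeasurable)
    (fun m ω => ((hL m).continuousOn ω).sub (hF.lipschitz.continuousOn (X k ω))) hpoint
  exact tendsto_of_tendsto_of_tendsto_of_le_of_le tendsto_const_nhds hJ (fun _ => zero_le)
    fun m => iSup₂_le fun Q hQ => secondMoment_lsValue_sub_value_le (hX k hkn) (hg k hkn) hF (hL m)
      hQ (hadm k hkn Q hQ)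

end LeastSquares

end SwingContract

end

theorem proposition4
    {Ω : Type*} [MeasurableSpace Ω] (μ : Measure Ω) [IsProbabilityMeasure μ]
    (d : ℕ) (c : SwingContract)
    (hQmin : 0 ≤ c.Qmin) (hQ : c.Qmin ≤ c.Qmax)
    (hadm : ∀ k < c.n, ∀ Q ∈ c.consumption k, (c.volumes k Q).Nonempty)
    (X : ℕ → Ω → EuclideanSpace ℝ (Fin d))
    (hX : ∀ k ≤ c.n, Measurable (X k))
    (hMarkov : SwingContract.IsMarkov μ c.n X)
    (g : ℕ → EuclideanSpace ℝ (Fin d) → ℝ)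
    (hg : ∀ k < c.n, Measurable (g k))
    (hg_growth : ∀ k < c.n, ∃ C : ℝ, ∀ x, |g k x| ≤ C * (1 + ‖x‖))
    (e : ℕ → EuclideanSpace ℝ (Fin d) → ℝ)
    (he : ∀ i, Measurable (e i))
    (he_sq : ∀ (k : Fin c.n) (i : ℕ), MemLp (fun ω => e i (X k ω)) 2 μ)
    (h_total : ∀ k : Fin c.n,
      (Submodule.span ℝ (Set.range fun i : ℕ => (he_sq k i).toLp)).topologicalClosure
        = lpMeas ℝ ℝ (MeasurableSpace.comap (X k) inferInstance) 2 μ)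
    (h_indep : ∀ k : Fin c.n, LinearIndependent ℝ (fun i : ℕ => (he_sq k i).toLp))
    (h_moment : ∀ k < c.n, MemLp (X k) 2 μ) :
    ∀ k < c.n,
      Tendsto
        (fun m : ℕ => ⨆ Q ∈ c.consumption k,
          eLpNorm (fun ω => c.lsValue μ X g e m k Q ω - c.value μ X g k (X k ω) Q) 2 μ)
        atTop (𝓝 0) := by
  have hgX : ∀ k < c.n, MemLp (fun ω => g k (X k ω) - c.strike) 2 μ := by
    intro k hk
    obtain ⟨C, hC⟩ := hg_growth k hk
    have hb : MemLp (fun ω => 1 + ‖X k ω‖) 2 μ :=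
      (memLp_const (1 : ℝ)).add (h_moment k hk).norm
    exact ((hb.const_mul C).mono' ((hg k hk).comp (hX k hk.le)).aestronglyMeasurable
      (Eventually.of_forall fun ω => hC _)).sub (memLp_const _)
  intro k hk
  have h := SwingContract.tendsto_iSup_secondMoment hadm (fun k hk => hX k hk.le) hg hgX he
    (fun k hk => he_sq ⟨k, hk⟩) (fun k hk => h_total ⟨k, hk⟩) (fun k hk => h_indep ⟨k, hk⟩) k hk
  rw [ENNReal.tendsto_nhds_zero] at h ⊢
  intro ε hε
  filter_upwards [h (ε ^ 2) (ENNReal.pow_pos hε 2)] with m hm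
  refine iSup₂_le fun Q hQ => (ENNReal.pow_le_pow_left_iff two_ne_zero).1 ?_
  rw [eLpNorm_two_sq]
  exact (iSup₂_le_iff.1 hm) Q hQ
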